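/- Let $N \cong \mathbb{Z}^2$ be a lattice of rank $2$, $M = \mathrm{Hom}(N,\mathbb{Z})$ its dual lattice, $N_{\mathbb R} = N\otimes\mathbb{R}$, $M_{\mathbb R} = M\otimes\mathbb{R}$, and $\langle\cdot,\cdot\rangle : M_{\mathbb R}\times N_{\mathbb R}\to\mathbb{R}$ the natural pairing. Let $\Delta\subseteq N_{\mathbb R}$ be an LDP-polygon, i.e. a convex lattice polygon (the convex hull of finitely many points of $N$) that contains the origin in its interior and whose vertices are primitive lattice points of $N$. Let $\Sigma$ be the fan of cones over the proper faces of $\Delta$ (the fan of the corresponding toric log del Pezzo surface), and let $\Delta^* = \{y\in M_{\mathbb R} \mid \langle y,x\rangle\ge -1 \text{ for all } x\in\Delta\}$ be the dual polygon. For a polygon $P$ in $N_{\mathbb R}$ or $M_{\mathbb R}$ let $v(P) = 2!\cdot\mathrm{vol}_2(P)$ be its normalized area, where $\mathrm{vol}_2$ is normalized so that a fundamental parallelogram of the lattice $N$, respectively $M$, has area $1$. There is exactly one function $\kappa : N_{\mathbb R}\to\mathbb{R}$ that is linear on every cone of $\Sigma$ and takes the value $-1$ on the primitive lattice generator of every one-dimensional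 cone of $\Sigma$ (the piecewise linear function of the anticanonical divisor); the set $\Delta\cap N$ is finite; and $$v(\Delta) + v(\Delta^*) = 12\sum_{n\in\Delta\cap N}(\kappa(n)+1)^2 .$$ In particular $v(\Delta)+v(\Delta^*)\ge 12$, and equality holds if and only if $\Delta$ is reflexive, i.e. if and only if all vertices of $\Delta^*$ belong to $M$. -/

import Mathlib

open MeasureTheory Module

noncomputable section

namespace LDP

variable {E : Type*} [NormedAddCommGroup E] [NormedSpace ℝ E]

/-- A primitive vector of the lattice `N`: a nonzero lattice vector that is not a proper integral
multiple of another lattice vector. -/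
def IsPrimitive (N : Submodule ℤ E) (u : E) : Prop :=
  u ∈ N ∧ u ≠ 0 ∧ ∀ w ∈ N, ∀ k : ℤ, u = k • w → IsUnit k

/-- The vertices of a convex set, as its extreme points. -/
def vertices (P : Set E) : Set E := P.extremePoints ℝ

/-- A lattice polytope: the convex hull of finitely many lattice points. -/
def IsLatticePolytope (N : Submodule ℤ E) (P : Set E) : Prop :=
  ∃ s : Finset E, (s : Set E) ⊆ N ∧ P = convexHull ℝ (s : Set E)

/-- An LDP-polytope: a convex lattice polytope with the origin in its interior, all of whose
vertices are primitive lattice points. It is an LDP-polygon if the ambient space is a plane. -/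
structure IsLDP (N : Submodule ℤ E) (P : Set E) : Prop where
  isLatticePolytope : IsLatticePolytope N P
  zero_mem_interior : (0 : E) ∈ interior P
  primitive_vertices : ∀ u ∈ vertices P, IsPrimitive N u

/-- The fan of cones over the proper faces of `P` (the empty face gives the cone `{0}`). -/
def faceFan (P : Set E) : Set (PointedCone ℝ E) :=
  {σ | ∃ F : Set E, IsExposed ℝ P F ∧ F ≠ P ∧ σ = PointedCone.hull ℝ F}

/-- The dimension of a cone. -/
def coneDim (σ : PointedCone ℝ E) : ℕ := finrank ℝ (Submodule.span ℝ (σ : Set E))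

/-- `κ` is the piecewise linear function of the anticanonical divisor of the fan `Fan`: it is
linear on every cone and takes the value `-1` on the primitive lattice generator of every
one-dimensional cone. -/
structure IsAnticanonical (N : Submodule ℤ E) (Fan : Set (PointedCone ℝ E)) (κ : E → ℝ) :
    Prop where
  linear_on_cone : ∀ σ ∈ Fan, ∃ m : E →ₗ[ℝ] ℝ, ∀ x ∈ σ, κ x = m x
  ray_generator : ∀ σ ∈ Fan, coneDim σ = 1 → ∀ u ∈ σ, IsPrimitive N u → κ u = -1

/-- The dual lattice `M = Hom(N, ℤ)`, inside the dual space. -/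
def dualLattice (N : Submodule ℤ E) : Submodule ℤ (StrongDual ℝ E) where
  carrier := {y | ∀ n ∈ N, ∃ k : ℤ, y n = k}
  zero_mem' := fun _ _ => ⟨0, by simp⟩
  add_mem' := by
    intro a b ha hb n hn
    obtain ⟨k, hk⟩ := ha n hn
    obtain ⟨l, hl⟩ := hb n hn
    exact ⟨k + l, by simp [hk, hl]⟩
  smul_mem' := by
    intro c a ha n hn
    obtain ⟨k, hk⟩ := ha n hn
    exact ⟨c * k, by simp [hk]⟩

/-- The dual polytope `{y | ⟨y, x⟩ ≥ -1 for all x ∈ P}`. -/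
def dualPolytope (P : Set E) : Set (StrongDual ℝ E) :=
  {y | ∀ x ∈ P, -1 ≤ y x}

/-- `P` is reflexive if all vertices of its dual polytope are points of the dual lattice. -/
def IsReflexive (N : Submodule ℤ E) (P : Set E) : Prop :=
  vertices (dualPolytope P) ⊆ (dualLattice N : Set (StrongDual ℝ E))

/-- The normalized volume `d! · vol_d`, where `vol_d` is the Haar measure for which a fundamental
parallelepiped of the lattice `L` has volume one. -/
def normalizedVolume {V : Type*} [NormedAddCommGroup V] [NormedSpace ℝ V] [FiniteDimensional ℝ V]
    [MeasurableSpace V] [BorelSpace V] (L : Submodule ℤ V) (P : Set V) : ℝ :=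
  (finrank ℝ V).factorial *
    ((Measure.addHaar : Measure V).real P / ZLattice.covolume L (Measure.addHaar : Measure V))

end LDP

end

/-!
The origin contributes `12` to the sum over the lattice points of `Δ`, and the vertices contribute
nothing, so everything happens in the open cones over the edges. For an edge from `u` to `v`,
complete `u` to a lattice basis `u`, `w` and write `v = h • u + d • w`: the lattice points of `Δ`
in the open cone are then parametrized by residues modulo `d`, and the sum over them is elementary
up to the Dedekind sum `s(h, d)`.

Fix lattice coordinates whose first axis contains no vertex. Rademacher's three-term law expresses
`s(h, d)` as the difference of the values at `u` and `v` of a function of a single vertex, plus a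
rational term and a sign term. Summed around the polygon the differences telescope; the rational
terms give the area of `Δ*`, cut into triangles with apex `0`; and the sign terms count the edges
that cross the first axis, of which there are exactly two, which produces the constant `12`.

Equality holds iff no lattice point of `Δ` lies strictly below an edge inside the open cone over it.
In the coordinates above this forces the linear form that is `1` on the edge to be integral, and
these forms are, up to sign, the vertices of `Δ*`.
-/

namespace LDP

section DedekindSum

/-- The sawtooth function `((x))`, which is `x - ⌊x⌋ - 1/2` off the integers and `0` on them. -/
noncomputable def saw (x : ℝ) : ℝ := if Int.fract x = 0 then 0 else Int.fract x - 1 / 2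

lemma saw_neg (x : ℝ) : saw (-x) = -saw x := by
  by_cases h : Int.fract x = 0
  · simp [saw, h, Int.fract_neg_eq_zero]
  · rw [saw, saw, if_neg h, if_neg (by rwa [Int.fract_neg_eq_zero]), Int.fract_neg h]
    ring

lemma saw_congr {k a b : ℤ} (h : k ∣ a - b) : saw (a / k) = saw (b / k) := by
  rcases eq_or_ne k 0 with rfl | hk
  · simp
  obtain ⟨c, hc⟩ := h
  have hab : (a : ℝ) / k = b / k + c := by
    rw [div_add' _ _ _ (by exact_mod_cast hk), show a = b + c * k by linarith]
    push_cast
    rfl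
  rw [hab, saw, saw, Int.fract_add_intCast]

lemma fract_intCast_div_intCast {k : ℤ} (hk : 0 < k) (a : ℤ) :
    Int.fract ((a : ℝ) / k) = (a % k : ℤ) / k := by
  lift k to ℕ using hk.le
  exact Int.fract_div_intCast_eq_div_intCast_mod

/-- The Dedekind sum `s(h, k)`, extended to negative moduli as an odd function of `k`. Its value
at `k = 0` is `0`; with this convention reciprocity and the three-term law below need no case
distinctions. -/
noncomputable def dedekindSum (h k : ℤ) : ℝ :=
  k.sign * ∑ j ∈ Finset.Ico 0 |k|, saw (j / k) * saw ((h * j : ℤ) / k)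

@[simp]
lemma dedekindSum_zero_right (h : ℤ) : dedekindSum h 0 = 0 := by simp [dedekindSum]

@[simp]
lemma dedekindSum_one_right (h : ℤ) : dedekindSum h 1 = 0 := by
  have : Finset.Ico (0 : ℤ) 1 = {0} := by decide
  simp [dedekindSum, this, saw]

lemma dedekindSum_neg_left (h k : ℤ) : dedekindSum (-h) k = -dedekindSum h k := by
  simp only [dedekindSum, neg_mul, Int.cast_neg, neg_div, saw_neg, mul_neg,
    Finset.sum_neg_distrib]

lemma dedekindSum_neg_right (h k : ℤ) : dedekindSum h (-k) = -dedekindSum h k := by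
  simp only [dedekindSum, Int.sign_neg, abs_neg, Int.cast_neg, div_neg, saw_neg, neg_mul,
    mul_neg, neg_neg]

lemma dedekindSum_congr {h h' k : ℤ} (hk : k ∣ h - h') : dedekindSum h k = dedekindSum h' k := by
  unfold dedekindSum
  congr! 3 with j
  exact saw_congr (by rw [← sub_mul]; exact hk.mul_right j)

lemma sum_Ico_mul_emod {M : Type*} [AddCommMonoid M] {h k : ℤ} (hk : 0 < k) (hc : IsCoprime h k)
    (f : ℤ → M) : ∑ j ∈ Finset.Ico 0 k, f (h * j % k) = ∑ j ∈ Finset.Ico 0 k, f j := by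
  have maps (c : ℤ) : ∀ j ∈ Finset.Ico 0 k, c * j % k ∈ Finset.Ico 0 k := fun j _ =>
    Finset.mem_Ico.2 ⟨Int.emod_nonneg _ hk.ne', Int.emod_lt_of_pos _ hk⟩
  have cancel {c d : ℤ} (hcd : k ∣ c * d - 1) :
      ∀ j ∈ Finset.Ico 0 k, c * (d * j % k) % k = j := fun j hj => by
    rw [Finset.mem_Ico] at hj
    calc c * (d * j % k) % k = c * (d * j) % k := (Int.mod_modEq _ _).mul_left c
      _ = j % k := (Int.modEq_iff_dvd.2 (by
        rw [show c * (d * j) - j = (c * d - 1) * j by ring]; exact hcd.mul_right j)).symm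
      _ = j := Int.emod_eq_of_lt hj.1 hj.2
  obtain ⟨a, b, hab⟩ := hc
  have ha : k ∣ a * h - 1 := ⟨-b, by linear_combination hab⟩
  exact Finset.sum_nbij' (h * · % k) (a * · % k) (maps h) (maps a) (cancel ha)
    (cancel (by rwa [mul_comm])) fun _ _ => rfl

lemma dedekindSum_inv {h h' k : ℤ} (hh : k ∣ h * h' - 1) : dedekindSum h k = dedekindSum h' k := by
  rcases eq_or_ne k 0 with rfl | hk
  · simp
  wlog hk0 : 0 < k generalizing k
  · have := this (k := -k) (neg_dvd.2 hh) (neg_ne_zero.2 hk) (by omega)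
    rwa [dedekindSum_neg_right, dedekindSum_neg_right, neg_inj] at this
  have hc : IsCoprime h k := by
    obtain ⟨c, hc⟩ := hh
    exact ⟨h', -c, by linear_combination hc⟩
  unfold dedekindSum
  rw [abs_of_pos hk0, ← sum_Ico_mul_emod hk0 hc fun j => saw (j / k) * saw ((h' * j : ℤ) / k)]
  congr! 2 with j
  rw [mul_comm, saw_congr (Int.dvd_self_sub_emod : k ∣ h * j - h * j % k),
    saw_congr (a := j) (b := h' * (h * j % k))]
  rw [show j - h' * (h * j % k) = h' * (h * j - h * j % k) - (h * h' - 1) * j by ring]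
  exact dvd_sub (Int.dvd_self_sub_emod.mul_left _) (hh.mul_right _)

lemma sum_Ico_intCast {k : ℤ} (hk : 0 ≤ k) :
    ∑ j ∈ Finset.Ico 0 k, (j : ℝ) = k * (k - 1) / 2 := by
  induction k, hk using Int.leInduction with
  | base => simp
  | succ n hn ih => rw [← Finset.sum_Ico_add_eq_sum_Ico_add_one hn, ih]; push_cast; ring

lemma sum_Ico_intCast_sq {k : ℤ} (hk : 0 ≤ k) :
    ∑ j ∈ Finset.Ico 0 k, (j : ℝ) ^ 2 = k * (k - 1) * (2 * k - 1) / 6 := by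
  induction k, hk using Int.leInduction with
  | base => simp
  | succ n hn ih => rw [← Finset.sum_Ico_add_eq_sum_Ico_add_one hn, ih]; push_cast; ring

lemma mul_emod_pos {h k j : ℤ} (hc : IsCoprime h k) (hj : j ∈ Finset.Ioo 0 k) :
    0 < h * j % k := by
  rw [Finset.mem_Ioo] at hj
  refine (Int.emod_nonneg _ (by omega)).lt_of_ne' fun h0 => ?_
  have := Int.le_of_dvd hj.1 (hc.symm.dvd_of_dvd_mul_left (Int.dvd_of_emod_eq_zero h0))
  omega

lemma sum_Ico_eq_add_sum_Ioo {M : Type*} [AddCommMonoid M] {k : ℤ} (hk : 0 < k) (f : ℤ → M) :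
    ∑ j ∈ Finset.Ico 0 k, f j = f 0 + ∑ j ∈ Finset.Ioo 0 k, f j := by
  rw [← Finset.Ioo_insert_left hk, Finset.sum_insert (by simp)]

lemma sum_Ioo_const {k : ℤ} (hk : 0 < k) (c : ℝ) : ∑ _j ∈ Finset.Ioo 0 k, c = (k - 1) * c := by
  have : ((k - 0 - 1).toNat : ℤ) = k - 1 := by omega
  rw [Finset.sum_const, Int.card_Ioo, nsmul_eq_mul, ← Int.cast_natCast, this]
  push_cast
  rfl

lemma dedekindSum_eq_sum_mul_emod {h k : ℤ} (hk : 0 < k) (hc : IsCoprime h k) :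
    dedekindSum h k =
      (∑ j ∈ Finset.Ico 0 k, (j : ℝ) * (h * j % k : ℤ)) / k ^ 2 - (k - 1) / 4 := by
  have hk' : (k : ℝ) ≠ 0 := by exact_mod_cast hk.ne'
  have saw_div {j : ℤ} (hj : 0 < j % k) : saw (j / k) = (j % k : ℤ) / k - 1 / 2 := by
    rw [saw, fract_intCast_div_intCast hk, if_neg]
    exact div_ne_zero (by exact_mod_cast hj.ne') hk'
  have hterm : ∀ j ∈ Finset.Ioo 0 k, saw (j / k) * saw ((h * j : ℤ) / k) =
      (j * (h * j % k : ℤ)) / k ^ 2 - (j + (h * j % k : ℤ)) / (2 * k) + 1 / 4 := fun j hj => by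
    have hj' := Finset.mem_Ioo.1 hj
    have hmod : j % k = j := Int.emod_eq_of_lt hj'.1.le hj'.2
    rw [saw_div (hmod.symm ▸ hj'.1), saw_div (mul_emod_pos hc hj), hmod]
    field_simp
    ring
  have hperm := sum_Ico_mul_emod hk hc fun j => (j : ℝ)
  rw [sum_Ico_intCast hk.le] at hperm
  have hlin := sum_Ico_intCast hk.le
  rw [dedekindSum, abs_of_pos hk, Int.sign_eq_one_of_pos hk]
  simp only [sum_Ico_eq_add_sum_Ioo hk, mul_zero, Int.zero_emod, Int.cast_zero, zero_add,
    zero_div] at hperm hlin ⊢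
  rw [show saw 0 = 0 by simp [saw], Finset.sum_congr rfl hterm, Finset.sum_add_distrib,
    Finset.sum_sub_distrib, ← Finset.sum_div, ← Finset.sum_div, Finset.sum_add_distrib, hperm, hlin,
    sum_Ioo_const hk]
  field_simp
  ring

lemma card_filter_le_mul_ediv {h k i : ℤ} (hk : 0 < k) (hc : IsCoprime h k)
    (hi : i ∈ Finset.Ioo 0 h) :
    ((Finset.Ico 0 k).filter fun j => i ≤ h * j / k).card = k - 1 - k * i / h := by
  have hpos := mul_emod_pos hc.symm hi
  rw [Finset.mem_Ioo] at hi
  have hh : 0 < h := by omega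
  have hlt : k * i / h < k := Int.ediv_lt_of_lt_mul hh (by nlinarith)
  have hnn : 0 ≤ k * i / h := Int.ediv_nonneg (by nlinarith) hh.le
  have hset : (Finset.Ico 0 k).filter (fun j => i ≤ h * j / k) = Finset.Ioo (k * i / h) k := by
    ext j
    -- No lattice point lies on the diagonal, so `k * i ≤ h * j` and `k * i < h * j` agree.
    have hne : k * i ≠ h * j := fun he => by simp [he] at hpos
    have hiff : i ≤ h * j / k ↔ k * i / h < j := by
      rw [Int.le_ediv_iff_mul_le hk, Int.ediv_lt_iff_lt_mul hh, mul_comm i, mul_comm j]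
      exact ⟨fun hle => lt_of_le_of_ne hle hne, le_of_lt⟩
    simp only [Finset.mem_filter, Finset.mem_Ico, Finset.mem_Ioo, hiff]
    omega
  rw [hset, Int.card_Ioo]
  omega

lemma sum_ediv_mul_succ {h k : ℤ} (hh : 0 < h) (hk : 0 < k) (hc : IsCoprime h k) :
    ∑ j ∈ Finset.Ico 0 k, ((h * j / k : ℤ) : ℝ) * ((h * j / k : ℤ) + 1) =
      ∑ i ∈ Finset.Ico 0 h, 2 * (i : ℝ) * (k - 1 - (k * i / h : ℤ)) := by
  have hterm : ∀ j ∈ Finset.Ico 0 k, ((h * j / k : ℤ) : ℝ) * ((h * j / k : ℤ) + 1) =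
      ∑ i ∈ Finset.Ico 0 h, if i ≤ h * j / k then 2 * (i : ℝ) else 0 := fun j hj => by
    rw [Finset.mem_Ico] at hj
    have hlt : h * j / k < h := Int.ediv_lt_of_lt_mul hk (by nlinarith)
    have hnn : 0 ≤ h * j / k := Int.ediv_nonneg (by nlinarith) hk.le
    have hset : (Finset.Ico 0 h).filter (· ≤ h * j / k) = Finset.Ico 0 (h * j / k + 1) := by
      ext i
      simp only [Finset.mem_filter, Finset.mem_Ico]
      omega
    rw [← Finset.sum_filter, hset, ← Finset.mul_sum, sum_Ico_intCast (by omega)]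
    push_cast
    ring
  rw [Finset.sum_congr rfl hterm, Finset.sum_comm]
  refine Finset.sum_congr rfl fun i hi => ?_
  rcases eq_or_ne i 0 with rfl | hi0
  · simp
  have hi' : i ∈ Finset.Ioo 0 h := by
    rw [Finset.mem_Ico] at hi
    rw [Finset.mem_Ioo]
    omega
  have hcard := congrArg (Int.cast : ℤ → ℝ) (card_filter_le_mul_ediv hk hc hi')
  push_cast at hcard
  rw [← Finset.sum_filter, Finset.sum_const, nsmul_eq_mul, hcard]
  ring

/-- The right-hand side of Dedekind's reciprocity law and of the three-term law. By the convention
`x / 0 = 0` it vanishes when one of the arguments does. -/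
noncomputable def dedekindCocycle (a b c : ℤ) : ℝ :=
  ((a : ℝ) ^ 2 + b ^ 2 + c ^ 2) / (12 * a * b * c) - (a * b * c).sign / 4

lemma dedekindCocycle_neg_left (a b c : ℤ) :
    dedekindCocycle (-a) b c = -dedekindCocycle a b c := by
  simp only [dedekindCocycle, neg_mul, mul_neg, Int.sign_neg, Int.cast_neg, even_two.neg_pow,
    div_neg]
  ring

lemma dedekindCocycle_neg_middle (a b c : ℤ) :
    dedekindCocycle a (-b) c = -dedekindCocycle a b c := by
  simp only [dedekindCocycle, neg_mul, mul_neg, Int.sign_neg, Int.cast_neg, even_two.neg_pow,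
    div_neg]
  ring

lemma dedekindSum_reciprocity_of_pos {h k : ℤ} (hh : 0 < h) (hk : 0 < k)
    (hc : IsCoprime h k) : dedekindSum h k + dedekindSum k h = dedekindCocycle h k 1 := by
  have hh' : (h : ℝ) ≠ 0 := by exact_mod_cast hh.ne'
  have hk' : (k : ℝ) ≠ 0 := by exact_mod_cast hk.ne'
  have quot {m n : ℤ} (hn : (n : ℝ) ≠ 0) (j : ℤ) :
      ((m * j / n : ℤ) : ℝ) = (m * j - (m * j % n : ℤ)) / n := by
    rw [eq_div_iff hn, eq_sub_iff_add_eq]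
    exact_mod_cast Int.ediv_mul_add_emod (m * j) n
  have hperm := sum_Ico_mul_emod hk hc fun j => (j : ℝ)
  have hperm_sq := sum_Ico_mul_emod hk hc fun j => (j : ℝ) ^ 2
  have hcount := sum_ediv_mul_succ hh hk hc
  have hleft : ∑ j ∈ Finset.Ico 0 k, ((h * j / k : ℤ) : ℝ) * ((h * j / k : ℤ) + 1) =
      ((h ^ 2 + 1) * (k * (k - 1) * (2 * k - 1) / 6) -
        2 * h * ∑ j ∈ Finset.Ico 0 k, (j : ℝ) * (h * j % k : ℤ)) / k ^ 2 +
        (h - 1) * (k - 1) / 2 := by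
    have hexpand (j : ℤ) : ((h * j / k : ℤ) : ℝ) * ((h * j / k : ℤ) + 1) =
        (h ^ 2 * j ^ 2 + (h * j % k : ℤ) ^ 2 - 2 * h * (j * (h * j % k : ℤ))) / k ^ 2 +
          (h * j - (h * j % k : ℤ)) / k := by
      rw [quot hk']
      field_simp
      ring
    simp only [hexpand, Finset.sum_add_distrib, ← Finset.sum_div, Finset.sum_sub_distrib,
      ← Finset.mul_sum, hperm, hperm_sq, sum_Ico_intCast hk.le, sum_Ico_intCast_sq hk.le]
    field_simp
  have hright : ∑ i ∈ Finset.Ico 0 h, 2 * (i : ℝ) * (k - 1 - (k * i / h : ℤ)) =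
      (k - 1) * (h * (h - 1)) - 2 * (k * (h * (h - 1) * (2 * h - 1) / 6) -
        ∑ i ∈ Finset.Ico 0 h, (i : ℝ) * (k * i % h : ℤ)) / h := by
    have hexpand (i : ℤ) : 2 * (i : ℝ) * (k - 1 - (k * i / h : ℤ)) =
        2 * (k - 1) * i - 2 * (k * i ^ 2 - i * (k * i % h : ℤ)) / h := by
      rw [quot hh']
      field_simp
    simp only [hexpand, Finset.sum_sub_distrib, ← Finset.sum_div, ← Finset.mul_sum,
      sum_Ico_intCast hh.le, sum_Ico_intCast_sq hh.le]
    ring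
  rw [hleft, hright] at hcount
  rw [dedekindSum_eq_sum_mul_emod hk hc, dedekindSum_eq_sum_mul_emod hh hc.symm, dedekindCocycle,
    Int.sign_eq_one_of_pos (by positivity)]
  field_simp at hcount ⊢
  push_cast
  linear_combination (-2 : ℝ) * hcount

theorem dedekindSum_reciprocity {h k : ℤ} (hc : IsCoprime h k) :
    dedekindSum h k + dedekindSum k h = dedekindCocycle h k 1 := by
  wlog hh : 0 ≤ h generalizing h
  · have := this hc.neg_left (by omega)
    rw [dedekindSum_neg_left, dedekindSum_neg_right, dedekindCocycle_neg_left] at this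
    linarith
  wlog hk : 0 ≤ k generalizing k
  · have := this hc.neg_right (by omega)
    rw [dedekindSum_neg_left, dedekindSum_neg_right, dedekindCocycle_neg_middle] at this
    linarith
  rcases hh.eq_or_lt with rfl | hh
  · obtain rfl : k = 1 := by
      have := Int.isUnit_iff.1 (isCoprime_zero_left.1 hc)
      omega
    simp [dedekindCocycle]
  rcases hk.eq_or_lt with rfl | hk
  · obtain rfl : h = 1 := by
      have := Int.isUnit_iff.1 (isCoprime_zero_right.1 hc)
      omega
    simp [dedekindCocycle]
  exact dedekindSum_reciprocity_of_pos hh hk hc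

lemma dedekindSum_sub_of_det_eq_one {p q p' q' : ℤ} (hdet : p * q' - q * p' = 1) :
    dedekindSum p' q' - dedekindSum p q = -dedekindCocycle q q' 1 := by
  have hpq : dedekindSum p q = dedekindSum q' q := dedekindSum_inv ⟨p', by linear_combination hdet⟩
  have hpq' : dedekindSum p' q' = -dedekindSum q q' := by
    rw [← dedekindSum_neg_left]
    exact dedekindSum_inv ⟨-p, by linear_combination hdet⟩
  rw [hpq, hpq', ← dedekindSum_reciprocity ⟨-p', p, by linear_combination hdet⟩]
  ring

lemma sign_mul_add_one_of_eq {q y q' c d : ℤ} (hd : 0 < d) (hc : 0 < c) (hq : q ≠ 0) (hy : y ≠ 0)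
    (h : q' = d * y - c * q) : (q * q').sign + 1 = (q * y).sign + (y * q').sign := by
  simp only [Int.sign_mul]
  rcases lt_or_gt_of_ne hq with hq | hq <;> rcases lt_or_gt_of_ne hy with hy | hy
  · rw [Int.sign_eq_neg_one_of_neg hq, Int.sign_eq_neg_one_of_neg hy]
    ring
  · rw [Int.sign_eq_neg_one_of_neg hq, Int.sign_eq_one_of_pos hy,
      Int.sign_eq_one_of_pos (show 0 < q' by nlinarith)]
    ring
  · rw [Int.sign_eq_neg_one_of_neg hy, Int.sign_eq_one_of_pos hq,
      Int.sign_eq_neg_one_of_neg (show q' < 0 by nlinarith)]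
    ring
  · rw [Int.sign_eq_one_of_pos hq, Int.sign_eq_one_of_pos hy]
    ring

lemma dedekindCocycle_eq_of_eq {q y q' c d : ℤ} (hd : 0 < d) (hc : 0 < c) (hq : q ≠ 0)
    (hq' : q' ≠ 0) (h : q' = d * y - c * q) (hy : y = 0 → IsUnit q) :
    dedekindCocycle q q' d =
      dedekindCocycle y q' c + dedekindCocycle q y 1 - dedekindCocycle c d 1 := by
  have hd' : (d : ℝ) ≠ 0 := by exact_mod_cast hd.ne'
  have hc' : (c : ℝ) ≠ 0 := by exact_mod_cast hc.ne'
  rcases eq_or_ne y 0 with rfl | hy0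
  · obtain rfl : q' = -(c * q) := by rw [h]; ring
    rcases Int.isUnit_iff.1 (hy rfl) with rfl | rfl <;>
      simp [dedekindCocycle, Int.sign_eq_one_of_pos, hd, hc] <;> field_simp <;> ring
  have hsign : ((q * q').sign : ℝ) + 1 = (q * y).sign + (y * q').sign := by
    exact_mod_cast sign_mul_add_one_of_eq hd hc hq hy0 h
  have hrat : ((q : ℝ) ^ 2 + q' ^ 2 + d ^ 2) / (12 * q * q' * d) =
      ((y : ℝ) ^ 2 + q' ^ 2 + c ^ 2) / (12 * y * q' * c) +
      ((q : ℝ) ^ 2 + y ^ 2 + 1) / (12 * q * y) - ((c : ℝ) ^ 2 + d ^ 2 + 1) / (12 * c * d) := by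
    have hq0 : (q : ℝ) ≠ 0 := by exact_mod_cast hq
    have hq0' : (q' : ℝ) ≠ 0 := by exact_mod_cast hq'
    have hy0' : (y : ℝ) ≠ 0 := by exact_mod_cast hy0
    have hR : (q' : ℝ) = d * y - c * q := by exact_mod_cast h
    field_simp
    rw [hR]
    ring
  simp only [dedekindCocycle, Int.sign_mul, Int.sign_eq_one_of_pos hd, Int.sign_eq_one_of_pos hc,
    mul_one, Int.cast_one, one_pow] at hsign ⊢
  linear_combination hrat - hsign / 4

lemma dedekindSum_of_zero_left_det {p p' q' k d : ℤ} (hdet : p * q' = d) (hd : d ≠ 0)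
    (hp : d ∣ p' - k * p) (hq : d ∣ q') : dedekindSum k d = dedekindSum p' q' := by
  have hunit : IsUnit p := by
    obtain ⟨c, rfl⟩ := hq
    exact IsUnit.of_mul_eq_one c (mul_left_cancel₀ hd (by linear_combination hdet))
  rcases Int.isUnit_iff.1 hunit with rfl | rfl
  · obtain rfl : q' = d := by omega
    exact dedekindSum_congr ((dvd_sub_comm).1 (by simpa using hp))
  · obtain rfl : d = -q' := by omega
    rw [dedekindSum_neg_right, ← dedekindSum_neg_left]
    obtain ⟨c, hc⟩ := hp
    exact dedekindSum_congr ⟨c, by linear_combination -hc⟩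

theorem dedekindSum_three_term {p q p' q' k d : ℤ} (hc : IsCoprime p' q') (hq' : q' ≠ 0)
    (hdet : p * q' - q * p' = d) (hd : 0 < d) (hkp : d ∣ p' - k * p) (hkq : d ∣ q' - k * q) :
    dedekindSum k d = dedekindSum p' q' - dedekindSum p q + dedekindCocycle q q' d := by
  induction hn : d.toNat using Nat.strong_induction_on generalizing p q k d with
  | _ n ih =>
  rcases eq_or_ne q 0 with rfl | hq
  · simpa [dedekindCocycle] using
      dedekindSum_of_zero_left_det (by simpa using hdet) hd.ne' hkp (by simpa using hkq)
  rcases eq_or_ne d 1 with rfl | hd1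
  · rw [dedekindSum_one_right, dedekindSum_sub_of_det_eq_one hdet, neg_add_cancel]
  -- The lattice point `(x, y) = ((p', q') + c • (p, q)) / d` splits the cone of determinant `d`
  -- into cones of determinants `1` and `c < d`.
  obtain ⟨c, hc_def⟩ : ∃ c, c = d - k % d := ⟨_, rfl⟩
  have hc0 : 0 < c := by linarith [Int.emod_lt_of_pos k hd]
  have hkc : d ∣ k + c := ⟨k / d + 1, by rw [hc_def]; linarith [Int.emod_add_mul_ediv k d]⟩
  obtain ⟨f, hf⟩ := id hkc
  obtain ⟨x, hx⟩ : d ∣ p' + c * p := by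
    obtain ⟨e, he⟩ := hkp
    exact ⟨e + f * p, by linear_combination he + p * hf⟩
  obtain ⟨y, hy⟩ : d ∣ q' + c * q := by
    obtain ⟨e, he⟩ := hkq
    exact ⟨e + f * q, by linear_combination he + q * hf⟩
  have hcd : IsCoprime c d := by
    obtain ⟨a, b, hab⟩ := hc
    exact ⟨-(a * p + b * q), a * x + b * y, by linear_combination hab - a * hx - b * hy⟩
  have hlt : c < d := by
    refine lt_of_le_of_ne (by linarith [Int.emod_nonneg k hd.ne']) fun h => hd1 ?_
    have := Int.isUnit_iff.1 (isCoprime_self.1 (h ▸ hcd))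
    omega
  have hdet1 : p * y - q * x = 1 :=
    mul_left_cancel₀ hd.ne' (by linear_combination hdet - p * hy + q * hx)
  have hsmall := ih c.toNat (by omega) (p := x) (q := y) (k := d) (d := c)
    (by linear_combination x * hy - y * hx + c * hdet1) hc0 ⟨-p, by linear_combination hx⟩
    ⟨-q, by linear_combination hy⟩ rfl
  have hcocycle := dedekindCocycle_eq_of_eq (y := y) hd hc0 hq hq' (by linear_combination hy)
    fun hy0 => IsUnit.of_mul_eq_one (-x) (by rw [hy0] at hdet1; linear_combination hdet1)
  have hkd : dedekindSum k d = -dedekindSum c d := by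
    rw [← dedekindSum_neg_left]
    exact dedekindSum_congr (by rwa [sub_neg_eq_add])
  linear_combination hkd + hsmall - dedekindSum_sub_of_det_eq_one hdet1 -
    dedekindSum_reciprocity hcd - hcocycle

lemma sum_mul_emod_sub_sq {h d : ℤ} (hd : 0 < d) (hc : IsCoprime h d) :
    ∑ j ∈ Finset.Ico 0 d, (((h * j % d : ℤ) - j : ℝ) / d) ^ 2 =
      (d - 3 + 2 / d) / 6 - 2 * dedekindSum h d := by
  have hd' : (d : ℝ) ≠ 0 := by exact_mod_cast hd.ne'
  have hexpand (j : ℤ) : (((h * j % d : ℤ) - j : ℝ) / d) ^ 2 =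
      ((h * j % d : ℤ) ^ 2 + j ^ 2 - 2 * (j * (h * j % d : ℤ))) / d ^ 2 := by
    rw [div_pow]
    ring
  simp only [hexpand, ← Finset.sum_div, Finset.sum_sub_distrib, Finset.sum_add_distrib,
    ← Finset.mul_sum, sum_Ico_mul_emod hd hc fun j => (j : ℝ) ^ 2, sum_Ico_intCast_sq hd.le,
    dedekindSum_eq_sum_mul_emod hd hc]
  field_simp
  ring

lemma sum_filter_le_mul_emod_sub_sq {h d : ℤ} (hd : 0 < d) (hc : IsCoprime h d) :
    ∑ j ∈ Finset.Ioo 0 d with j ≤ h * j % d, (((h * j % d : ℤ) - j : ℝ) / d) ^ 2 =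
      (d - 3 + 2 / d) / 12 - dedekindSum h d := by
  have hreflect : ∀ j ∈ Finset.Ioo 0 d, h * (d - j) % d = d - h * j % d := fun j hj => by
    have hpos := mul_emod_pos hc hj
    have hlt := Int.emod_lt_of_pos (h * j) hd
    obtain ⟨c, hc⟩ : d ∣ h * j - h * j % d := Int.dvd_self_sub_emod
    calc h * (d - j) % d = (d - h * j % d) % d :=
          Int.modEq_iff_dvd.2 ⟨1 - h + c, by linear_combination hc⟩
      _ = d - h * j % d := Int.emod_eq_of_lt (by omega) (by omega)
  have hsymm : ∑ j ∈ Finset.Ioo 0 d with j ≤ h * j % d, (((h * j % d : ℤ) - j : ℝ) / d) ^ 2 =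
      ∑ j ∈ Finset.Ioo 0 d with h * j % d ≤ j, (((h * j % d : ℤ) - j : ℝ) / d) ^ 2 := by
    have maps {P Q : ℤ → Prop} [DecidablePred P] [DecidablePred Q]
        (hPQ : ∀ j ∈ Finset.Ioo 0 d, P j → Q (d - j)) :
        ∀ j ∈ (Finset.Ioo 0 d).filter P, d - j ∈ (Finset.Ioo 0 d).filter Q := fun j hj => by
      obtain ⟨hj, hP⟩ := Finset.mem_filter.1 hj
      refine Finset.mem_filter.2 ⟨?_, hPQ j hj hP⟩
      rw [Finset.mem_Ioo] at hj ⊢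
      omega
    refine Finset.sum_nbij' (d - ·) (d - ·)
      (maps fun j hj hle => by rw [hreflect j hj]; omega)
      (maps fun j hj hle => by rw [hreflect j hj]; omega)
      (fun _ _ => sub_sub_cancel _ _) (fun _ _ => sub_sub_cancel _ _) fun j hj => ?_
    rw [hreflect j (Finset.mem_filter.1 hj).1]
    push_cast
    ring
  have hdrop : ∑ j ∈ Finset.Ioo 0 d with h * j % d ≤ j, (((h * j % d : ℤ) - j : ℝ) / d) ^ 2 =
      ∑ j ∈ Finset.Ioo 0 d with ¬ j ≤ h * j % d, (((h * j % d : ℤ) - j : ℝ) / d) ^ 2 := by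
    refine (Finset.sum_subset (fun j => ?_) fun j hj hj' => ?_).symm
    · simp only [Finset.mem_filter]
      exact fun hj => ⟨hj.1, (not_le.1 hj.2).le⟩
    · simp only [Finset.mem_filter, not_and, not_not] at hj hj'
      rw [le_antisymm hj.2 (hj' hj.1), sub_self, zero_div, zero_pow two_ne_zero]
  have hsplit := Finset.sum_filter_add_sum_filter_not (Finset.Ioo 0 d) (fun j => j ≤ h * j % d)
    fun j => (((h * j % d : ℤ) - j : ℝ) / d) ^ 2
  have htotal := sum_mul_emod_sub_sq hd hc
  rw [sum_Ico_eq_add_sum_Ioo hd, ← hsplit, ← hdrop, ← hsymm] at htotal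
  simp only [mul_zero, Int.zero_emod, sub_self, zero_div, zero_pow two_ne_zero, zero_add,
    Int.cast_zero] at htotal
  linarith

end DedekindSum

section Plane

variable {E : Type*} [AddCommGroup E] [Module ℝ E] (b : Basis (Fin 2) ℝ E)

/-- The determinant of two vectors of a plane, written in the coordinates of the basis `b`. -/
noncomputable def cross : E →ₗ[ℝ] E →ₗ[ℝ] ℝ :=
  LinearMap.mk₂ ℝ (fun x y => b.coord 0 x * b.coord 1 y - b.coord 1 x * b.coord 0 y)
    (fun x y z => by simp only [map_add]; ring)
    (fun c x y => by simp only [map_smul, smul_eq_mul]; ring)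
    (fun x y z => by simp only [map_add]; ring)
    (fun c x y => by simp only [map_smul, smul_eq_mul]; ring)

lemma cross_apply (x y : E) :
    cross b x y = b.coord 0 x * b.coord 1 y - b.coord 1 x * b.coord 0 y := rfl

@[simp]
lemma cross_self (x : E) : cross b x x = 0 := by
  rw [cross_apply]; ring

lemma cross_swap (x y : E) : cross b x y = -cross b y x := by
  rw [cross_apply, cross_apply]; ring

lemma cross_smul_eq (u v x : E) :
    cross b u v • x = cross b x v • u + cross b u x • v := by
  refine b.ext_elem fun i => ?_
  simp only [map_add, map_smul, Finsupp.add_apply, Finsupp.smul_apply, smul_eq_mul, cross_apply,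
    Basis.coord_apply]
  fin_cases i <;> simp <;> ring

lemma cross_mul_map (f : E →ₗ[ℝ] ℝ) (u v x : E) :
    cross b u v * f x = cross b x v * f u + cross b u x * f v := by
  simpa only [map_add, map_smul, smul_eq_mul] using congrArg f (cross_smul_eq b u v x)

lemma eq_of_cross_pos {u v : E} (h : 0 < cross b u v) (x : E) :
    x = (cross b x v / cross b u v) • u + (cross b u x / cross b u v) • v := by
  rw [div_eq_inv_mul, div_eq_inv_mul, mul_smul, mul_smul, ← smul_add, ← cross_smul_eq,
    inv_smul_smul₀ h.ne']

variable {b} in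
lemma linearMap_eq_of_cross_pos {u v : E} (h : 0 < cross b u v) {f g : E →ₗ[ℝ] ℝ}
    (hu : f u = g u) (hv : f v = g v) : f = g := by
  ext x
  refine mul_left_cancel₀ h.ne' ?_
  rw [cross_mul_map b f, cross_mul_map b g, hu, hv]

/-- The linear form with value `1` at `u` and at `v`, provided these are linearly independent. -/
noncomputable def edgeForm (u v : E) : E →ₗ[ℝ] ℝ :=
  (cross b u v)⁻¹ • (cross b u + (cross b).flip v)

lemma edgeForm_apply (u v x : E) :
    edgeForm b u v x = (cross b u x + cross b x v) / cross b u v := by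
  rw [div_eq_inv_mul]
  rfl

variable {b} in
lemma edgeForm_left {u v : E} (h : 0 < cross b u v) : edgeForm b u v u = 1 := by
  rw [edgeForm_apply, cross_self, zero_add, div_self h.ne']

variable {b} in
lemma edgeForm_right {u v : E} (h : 0 < cross b u v) : edgeForm b u v v = 1 := by
  rw [edgeForm_apply, cross_self, add_zero, div_self (ne_of_gt h)]

/-- Membership in the closed cone spanned by the positively oriented pair `u`, `v`. -/
def InCone (u v x : E) : Prop := 0 ≤ cross b u x ∧ 0 ≤ cross b x v

variable {b}

lemma mem_convexHull_triangle {x y z : E} :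
    z ∈ convexHull ℝ {0, x, y} ↔ ∃ s t : ℝ, 0 ≤ s ∧ 0 ≤ t ∧ s + t ≤ 1 ∧ z = s • x + t • y := by
  constructor
  · intro hz
    rw [convexHull_insert (Set.insert_nonempty _ _), convexHull_pair, mem_convexJoin] at hz
    obtain ⟨_, rfl, w, ⟨s, t, hs, ht, hst, rfl⟩, c, d, hc, hd, hcd, rfl⟩ := hz
    refine ⟨d * s, d * t, by positivity, by positivity, ?_, ?_⟩
    · rw [← mul_add, hst]
      linarith
    · rw [smul_zero, zero_add, smul_add, mul_smul, mul_smul]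
  · rintro ⟨s, t, hs, ht, hst, rfl⟩
    have hsub := (convex_convexHull ℝ {0, x, y}).sum_mem (t := Finset.univ) (z := ![0, x, y])
      (w := ![1 - (s + t), s, t])
      (by simpa [Fin.forall_fin_succ] using ⟨hst, hs, ht⟩)
      (by rw [Fin.sum_univ_three]; simp [add_assoc])
      (fun i _ => subset_convexHull ℝ _ (by fin_cases i <;> simp))
    simpa [Fin.sum_univ_three] using hsub

lemma mem_triangle_iff {u v z : E} (h : 0 < cross b u v) :
    z ∈ convexHull ℝ {0, u, v} ↔ InCone b u v z ∧ edgeForm b u v z ≤ 1 := by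
  rw [mem_convexHull_triangle]
  constructor
  · rintro ⟨s, t, hs, ht, hst, rfl⟩
    have hu : cross b u (s • u + t • v) = t * cross b u v := by simp
    have hv : cross b (s • u + t • v) v = s * cross b u v := by simp
    refine ⟨⟨by rw [hu]; positivity, by rw [hv]; positivity⟩, ?_⟩
    rw [edgeForm_apply, hu, hv, ← add_mul, mul_div_cancel_right₀ _ h.ne']
    linarith
  · rintro ⟨⟨hu, hv⟩, hle⟩
    refine ⟨cross b z v / cross b u v, cross b u z / cross b u v, by positivity, by positivity, ?_,
      eq_of_cross_pos b h z⟩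
    rwa [← add_div, add_comm, ← edgeForm_apply]

end Plane

section Polygon

variable {E : Type*} [AddCommGroup E] [Module ℝ E] (b : Basis (Fin 2) ℝ E)

/-- `P` is a convex polygon with set of vertices `V` around the origin. That the origin is an
interior point is expressed by `exists_cross_pos`: every open half-plane bounded by a line through
the origin contains a vertex. -/
structure IsPolygon (P : Set E) (V : Finset E) : Prop where
  eq_hull : P = convexHull ℝ (V : Set E)
  zero_mem : (0 : E) ∈ P
  exists_cross_pos : ∀ x : E, x ≠ 0 → ∃ v ∈ V, 0 < cross b x v
  extreme : (V : Set E) ⊆ P.extremePoints ℝ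
  ne_zero : ∀ u ∈ V, u ≠ 0

/-- `u`, `v` is a positively oriented edge of the polygon with set of vertices `V`: all vertices
lie on the same side of the line through `u` and `v` as the origin. -/
structure IsEdge (V : Finset E) (u v : E) : Prop where
  left_mem : u ∈ V
  right_mem : v ∈ V
  pos : 0 < cross b u v
  cross_add_le : ∀ x ∈ V, cross b u x + cross b x v ≤ cross b u v

variable {b} {P : Set E} {V : Finset E}

namespace IsEdge

variable {u v u' v' x : E}

lemma edgeForm_le (h : IsEdge b V u v) (hx : x ∈ V) : edgeForm b u v x ≤ 1 := by
  rw [edgeForm_apply, div_le_one h.pos]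
  exact h.cross_add_le x hx

lemma edgeForm_le_of_inCone (h : IsEdge b V u v) (h' : IsEdge b V u' v') (hx : InCone b u v x) :
    edgeForm b u' v' x ≤ edgeForm b u v x := by
  rw [edgeForm_apply b u v, le_div_iff₀ h.pos, mul_comm, cross_mul_map, add_comm]
  exact add_le_add (mul_le_of_le_one_right hx.1 (h'.edgeForm_le h.right_mem))
    (mul_le_of_le_one_right hx.2 (h'.edgeForm_le h.left_mem))

end IsEdge

namespace IsPolygon

lemma convex (hP : IsPolygon b P V) : Convex ℝ P := by
  rw [hP.eq_hull]; exact convex_convexHull ℝ _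

lemma vertex_mem (hP : IsPolygon b P V) {u : E} (hu : u ∈ V) : u ∈ P :=
  extremePoints_subset (hP.extreme hu)

lemma le_one_of_smul_mem (hP : IsPolygon b P V) {u : E} (hu : u ∈ V) {c : ℝ} (h : c • u ∈ P) :
    c ≤ 1 := by
  by_contra! hc
  have hc0 : 0 < c := zero_lt_one.trans hc
  have hmem : u ∈ openSegment ℝ 0 (c • u) :=
    ⟨1 - c⁻¹, c⁻¹, sub_pos.2 (inv_lt_one_of_one_lt₀ hc), inv_pos.2 hc0, sub_add_cancel _ _, by
      rw [smul_zero, zero_add, inv_smul_smul₀ hc0.ne']⟩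
  exact hP.ne_zero u hu
    ((mem_extremePoints.1 (hP.extreme hu)).2 0 hP.zero_mem (c • u) h hmem).1.symm

lemma cross_add_le_of_nonpos_of_pos (hP : IsPolygon b P V) {u v x : E} (hu : u ∈ V) (hv : v ∈ P)
    (hx : x ∈ P) (hux : cross b u x ≤ 0) (huv : 0 < cross b u v) :
    cross b u x + cross b x v ≤ cross b u v := by
  set d := cross b u v - cross b u x
  have hd0 : 0 < d := by linarith
  -- the point where the segment from `x` to `v` meets the line spanned by `u`
  have hmem : (cross b u v / d) • x + (-cross b u x / d) • v ∈ P :=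
    hP.convex hx hv (by positivity) (div_nonneg (by linarith) hd0.le) (by field_simp; linarith)
  have heq : (cross b u v / d) • x + (-cross b u x / d) • v = (cross b x v / d) • u := by
    rw [div_eq_inv_mul, div_eq_inv_mul, div_eq_inv_mul, mul_smul, mul_smul, mul_smul, ← smul_add,
      cross_smul_eq, neg_smul, add_neg_cancel_right]
  rw [heq] at hmem
  have := (div_le_one hd0).1 (hP.le_one_of_smul_mem hu hmem)
  linarith

lemma exists_isEdge_left (hP : IsPolygon b P V) {u : E} (hu : u ∈ V) : ∃ v, IsEdge b V u v := by
  classical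
  obtain ⟨w, hw, hw0⟩ := hP.exists_cross_pos u (hP.ne_zero u hu)
  -- the slope of the segment from `u` to `x`, in the coordinates of the basis `u`, `w`
  let slope (x : E) : ℝ := (cross b x w - cross b u w) / cross b u x
  obtain ⟨v, hv, hmax⟩ := (V.filter fun x => 0 < cross b u x).exists_max_image slope
    ⟨w, Finset.mem_filter.2 ⟨hw, hw0⟩⟩
  obtain ⟨hvV, hv0⟩ := Finset.mem_filter.1 hv
  refine ⟨v, hu, hvV, hv0, fun x hx => ?_⟩
  rcases le_or_gt (cross b u x) 0 with hx0 | hx0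
  · exact hP.cross_add_le_of_nonpos_of_pos hu (hP.vertex_mem hvV) (hP.vertex_mem hx) hx0 hv0
  · have hle := hmax x (Finset.mem_filter.2 ⟨hx, hx0⟩)
    rw [div_le_div_iff₀ hx0 hv0] at hle
    have plucker : cross b u w * cross b x v =
        cross b x w * cross b u v - cross b v w * cross b u x := by
      simp only [cross_apply]; ring
    refine le_of_mul_le_mul_left ?_ hw0
    linarith

lemma eq_or_eq_of_edgeForm_eq_one (hP : IsPolygon b P V) {u v z : E} (h : IsEdge b V u v)
    (hz : z ∈ V) (hz1 : edgeForm b u v z = 1) : z = u ∨ z = v := by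
  have eq_of_mem_segment {x y w : E} (hx : x ∈ V) (hy : y ∈ V) (hw : w ∈ V)
      (hmem : Wbtw ℝ x w y) : x = w ∨ y = w :=
    (mem_extremePoints_iff_forall_segment.1 (hP.extreme hw)).2 x (hP.vertex_mem hx) y
      (hP.vertex_mem hy) (mem_segment_iff_wbtw.2 hmem)
  have hne : u ≠ v := by
    rintro rfl
    exact h.pos.ne' (cross_self b u)
  have hcol : Collinear ℝ {u, z, v} := by
    rw [collinear_iff_of_mem (p₀ := u) (by simp)]
    refine ⟨v - u, ?_⟩
    rintro p (rfl | rfl | rfl)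
    · exact ⟨0, by simp⟩
    · refine ⟨cross b u p / cross b u v, ?_⟩
      have hz2 : cross b p v / cross b u v = 1 - cross b u p / cross b u v := by
        rw [eq_sub_iff_add_eq', ← add_div, ← edgeForm_apply, hz1]
      nth_rw 1 [eq_of_cross_pos b h.pos p]
      rw [hz2, vadd_eq_add]
      module
    · exact ⟨1, by simp⟩
  rcases hcol.wbtw_or_wbtw_or_wbtw with hw | hw | hw
  · exact (eq_of_mem_segment h.left_mem h.right_mem hz hw).imp Eq.symm Eq.symm
  · exact Or.inr ((eq_of_mem_segment hz h.left_mem h.right_mem hw).resolve_right hne)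
  · exact Or.inl ((eq_of_mem_segment h.right_mem hz h.left_mem hw).resolve_left hne.symm)

lemma eq_of_edgeForm_eq_one (hP : IsPolygon b P V) {u v u' v' : E} (h : IsEdge b V u v)
    (h' : IsEdge b V u' v') (hu : edgeForm b u' v' u = 1) (hv : edgeForm b u' v' v = 1) :
    u = u' ∧ v = v' := by
  have hpos := h.pos
  rcases hP.eq_or_eq_of_edgeForm_eq_one h' h.left_mem hu with rfl | rfl <;>
    rcases hP.eq_or_eq_of_edgeForm_eq_one h' h.right_mem hv with rfl | rfl
  · exact absurd (cross_self b _) hpos.ne'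
  · exact ⟨rfl, rfl⟩
  · rw [cross_swap] at hpos
    exact absurd (neg_pos.1 hpos) h'.pos.not_gt
  · exact absurd (cross_self b _) hpos.ne'

lemma right_unique (hP : IsPolygon b P V) {u v v' : E} (h : IsEdge b V u v)
    (h' : IsEdge b V u v') : v = v' := by
  refine (hP.eq_of_edgeForm_eq_one h h' (edgeForm_left h'.pos) ?_).2
  rw [edgeForm_apply, div_eq_one_iff_eq h'.pos.ne']
  linarith [h.cross_add_le v' h'.right_mem, h'.cross_add_le v h.right_mem, cross_swap b v v']

lemma left_unique (hP : IsPolygon b P V) {u u' v : E} (h : IsEdge b V u v)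
    (h' : IsEdge b V u' v) : u = u' := by
  refine (hP.eq_of_edgeForm_eq_one h h' ?_ (edgeForm_right h'.pos)).1
  rw [edgeForm_apply, div_eq_one_iff_eq h'.pos.ne']
  linarith [h.cross_add_le u' h'.left_mem, h'.cross_add_le u h.left_mem, cross_swap b u u']

lemma exists_next (hP : IsPolygon b P V) : ∃ next : E → E, ∀ u ∈ V, IsEdge b V u (next u) := by
  choose! next hnext using fun (u : E) (hu : u ∈ V) => hP.exists_isEdge_left hu
  exact ⟨next, hnext⟩

lemma exists_isEdge_right (hP : IsPolygon b P V) {v : E} (hv : v ∈ V) : ∃ u, IsEdge b V u v := by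
  obtain ⟨next, hnext⟩ := hP.exists_next
  have hinj : Set.InjOn next V := fun u hu w hw h => hP.left_unique (hnext u hu) (h ▸ hnext w hw)
  obtain ⟨u, hu, rfl⟩ :=
    Finset.surjOn_of_injOn_of_card_le next (fun u hu => (hnext u hu).right_mem) hinj le_rfl hv
  exact ⟨u, hnext u hu⟩

lemma edgeForm_next_lt (hP : IsPolygon b P V) {u v w : E} (h : IsEdge b V u v)
    (h' : IsEdge b V v w) : edgeForm b u v w < 1 := by
  refine lt_of_le_of_ne (h.edgeForm_le h'.right_mem) fun heq => h'.pos.ne' ?_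
  rw [(hP.eq_of_edgeForm_eq_one h' h (edgeForm_right h.pos) heq).2, cross_self]

lemma edgeForm_prev_lt (hP : IsPolygon b P V) {t u v : E} (h : IsEdge b V t u)
    (h' : IsEdge b V u v) : edgeForm b u v t < 1 := by
  refine lt_of_le_of_ne (h'.edgeForm_le h.left_mem) fun heq => h.pos.ne' ?_
  rw [(hP.eq_of_edgeForm_eq_one h h' heq (edgeForm_left h'.pos)).1, cross_self]

lemma cross_left_nonneg (hP : IsPolygon b P V) {t u v x : E} (h : IsEdge b V t u)
    (h' : IsEdge b V u v) (hx : edgeForm b t u x ≤ edgeForm b u v x) : 0 ≤ cross b u x := by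
  have key := cross_mul_map b (edgeForm b u v - edgeForm b t u) t u x
  simp only [LinearMap.sub_apply, edgeForm_left h.pos, edgeForm_right h.pos, edgeForm_left h'.pos,
    sub_self, mul_zero, add_zero] at key
  have hprod : 0 ≤ cross b u x * (1 - edgeForm b u v t) := by
    have := mul_nonneg h.pos.le (sub_nonneg.2 hx)
    rw [key, cross_swap] at this
    linarith
  exact nonneg_of_mul_nonneg_left hprod (sub_pos.2 (hP.edgeForm_prev_lt h h'))

lemma cross_right_nonneg (hP : IsPolygon b P V) {u v w x : E} (h : IsEdge b V u v)
    (h' : IsEdge b V v w) (hx : edgeForm b v w x ≤ edgeForm b u v x) : 0 ≤ cross b x v := by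
  have key := cross_mul_map b (edgeForm b u v - edgeForm b v w) v w x
  simp only [LinearMap.sub_apply, edgeForm_left h'.pos, edgeForm_right h'.pos,
    edgeForm_right h.pos, sub_self, mul_zero, zero_add] at key
  have hprod : 0 ≤ cross b x v * (1 - edgeForm b u v w) := by
    have := mul_nonneg h'.pos.le (sub_nonneg.2 hx)
    rw [key, cross_swap] at this
    linarith
  exact nonneg_of_mul_nonneg_left hprod (sub_pos.2 (hP.edgeForm_next_lt h h'))

lemma inCone_of_forall_le (hP : IsPolygon b P V) {u v x : E} (h : IsEdge b V u v)
    (hx : ∀ u' v', IsEdge b V u' v' → edgeForm b u' v' x ≤ edgeForm b u v x) :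
    InCone b u v x := by
  obtain ⟨t, ht⟩ := hP.exists_isEdge_right h.left_mem
  obtain ⟨w, hw⟩ := hP.exists_isEdge_left h.right_mem
  exact ⟨hP.cross_left_nonneg ht h (hx t u ht), hP.cross_right_nonneg h hw (hx v w hw)⟩

end IsPolygon

open Classical in
/-- The finite set of positively oriented edges of the polygon with set of vertices `V`. -/
noncomputable def edges (b : Basis (Fin 2) ℝ E) (V : Finset E) : Finset (E × E) :=
  (V ×ˢ V).filter fun σ => IsEdge b V σ.1 σ.2

lemma mem_edges {σ : E × E} : σ ∈ edges b V ↔ IsEdge b V σ.1 σ.2 := by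
  simp only [edges, Finset.mem_filter, Finset.mem_product, and_iff_right_iff_imp]
  exact fun h => ⟨h.left_mem, h.right_mem⟩

namespace IsPolygon

lemma edges_nonempty (hP : IsPolygon b P V) : (edges b V).Nonempty := by
  obtain ⟨u, hu, -⟩ := hP.exists_cross_pos (b 0) (b.ne_zero 0)
  obtain ⟨v, hv⟩ := hP.exists_isEdge_left hu
  exact ⟨(u, v), mem_edges.2 hv⟩

lemma exists_inCone (hP : IsPolygon b P V) (x : E) :
    ∃ u v, IsEdge b V u v ∧ InCone b u v x := by
  obtain ⟨σ, hσ, hmax⟩ := Finset.exists_max_image (edges b V) (fun σ => edgeForm b σ.1 σ.2 x)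
    hP.edges_nonempty
  exact ⟨σ.1, σ.2, mem_edges.1 hσ, hP.inCone_of_forall_le (mem_edges.1 hσ)
    fun u' v' h => hmax (u', v') (mem_edges.2 h)⟩

lemma eq_of_inCone_of_pos (hP : IsPolygon b P V) {u v u' v' x : E} (h : IsEdge b V u v)
    (h' : IsEdge b V u' v') (hu : 0 < cross b u x) (hv : 0 < cross b x v)
    (hx : InCone b u' v' x) : u = u' ∧ v = v' := by
  have hle := mul_le_mul_of_nonneg_left (h'.edgeForm_le_of_inCone h hx) h.pos.le
  rw [cross_mul_map b (edgeForm b u v) u v, cross_mul_map b (edgeForm b u' v') u v,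
    edgeForm_left h.pos, edgeForm_right h.pos] at hle
  have hu1 := h'.edgeForm_le h.left_mem
  have hv1 := h'.edgeForm_le h.right_mem
  have hule := mul_le_of_le_one_right hv.le hu1
  have hvle := mul_le_of_le_one_right hu.le hv1
  refine hP.eq_of_edgeForm_eq_one h h' (hu1.antisymm ?_) (hv1.antisymm ?_)
  · exact le_of_mul_le_mul_left (by linarith) hv
  · exact le_of_mul_le_mul_left (by linarith) hu

lemma edgeForm_le_of_mem (hP : IsPolygon b P V) {u v x : E} (h : IsEdge b V u v) (hx : x ∈ P) :
    edgeForm b u v x ≤ 1 := by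
  rw [hP.eq_hull] at hx
  exact convexHull_min (fun z hz => h.edgeForm_le hz)
    (convex_halfSpace_le (edgeForm b u v).isLinear 1) hx

lemma mem_of_inCone (hP : IsPolygon b P V) {u v x : E} (h : IsEdge b V u v)
    (hx : InCone b u v x) (hx1 : edgeForm b u v x ≤ 1) : x ∈ P := by
  refine convexHull_min ?_ hP.convex ((mem_triangle_iff h.pos).2 ⟨hx, hx1⟩)
  rintro _ (rfl | rfl | rfl)
  exacts [hP.zero_mem, hP.vertex_mem h.left_mem, hP.vertex_mem h.right_mem]

lemma sum_edges_fst {M : Type*} [AddCommMonoid M] (hP : IsPolygon b P V) (f : E → M) :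
    ∑ σ ∈ edges b V, f σ.1 = ∑ u ∈ V, f u := by
  refine Finset.sum_nbij Prod.fst (fun σ hσ => (mem_edges.1 hσ).left_mem) ?_ ?_ fun _ _ => rfl
  · intro σ hσ τ hτ h
    exact Prod.ext h (hP.right_unique (mem_edges.1 hσ) (h ▸ mem_edges.1 hτ))
  · intro u hu
    obtain ⟨v, hv⟩ := hP.exists_isEdge_left hu
    exact ⟨(u, v), mem_edges.2 hv, rfl⟩

lemma sum_edges_snd {M : Type*} [AddCommMonoid M] (hP : IsPolygon b P V) (f : E → M) :
    ∑ σ ∈ edges b V, f σ.2 = ∑ u ∈ V, f u := by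
  refine Finset.sum_nbij Prod.snd (fun σ hσ => (mem_edges.1 hσ).right_mem) ?_ ?_ fun _ _ => rfl
  · intro σ hσ τ hτ h
    exact Prod.ext (hP.left_unique (mem_edges.1 hσ) (h ▸ mem_edges.1 hτ)) h
  · intro v hv
    obtain ⟨u, hu⟩ := hP.exists_isEdge_right hv
    exact ⟨(u, v), mem_edges.2 hu, rfl⟩

lemma eq_biUnion_triangle (hP : IsPolygon b P V) :
    P = ⋃ σ ∈ edges b V, convexHull ℝ {0, σ.1, σ.2} := by
  ext x
  rw [Set.mem_iUnion₂]
  constructor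
  · intro hx
    obtain ⟨u, v, h, hc⟩ := hP.exists_inCone x
    exact ⟨(u, v), mem_edges.2 h, (mem_triangle_iff h.pos).2 ⟨hc, hP.edgeForm_le_of_mem h hx⟩⟩
  · rintro ⟨σ, hσ, hx⟩
    have h := mem_edges.1 hσ
    obtain ⟨hcone, hle⟩ := (mem_triangle_iff h.pos).1 hx
    exact hP.mem_of_inCone h hcone hle

lemma edgeForm_injective (hP : IsPolygon b P V) {u v u' v' : E} (h : IsEdge b V u v)
    (h' : IsEdge b V u' v') (heq : edgeForm b u v = edgeForm b u' v') : u = u' ∧ v = v' :=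
  hP.eq_of_edgeForm_eq_one h h' (heq ▸ edgeForm_left h.pos) (heq ▸ edgeForm_right h.pos)

lemma exists_separating_form (hP : IsPolygon b P V) {σ τ : E × E}
    (hσ : σ ∈ edges b V) (hτ : τ ∈ edges b V) (hne : σ ≠ τ) :
    ∃ f : E →ₗ[ℝ] ℝ, f ≠ 0 ∧ ∀ z ∈ convexHull ℝ {0, σ.1, σ.2},
      z ∈ convexHull ℝ {0, τ.1, τ.2} → f z = 0 := by
  have h := mem_edges.1 hσ
  have h' := mem_edges.1 hτ
  refine ⟨edgeForm b σ.1 σ.2 - edgeForm b τ.1 τ.2, fun h0 => ?_, fun z hz hz' => ?_⟩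
  · obtain ⟨h1, h2⟩ := hP.edgeForm_injective h h' (sub_eq_zero.1 h0)
    exact hne (Prod.ext h1 h2)
  · have hc := ((mem_triangle_iff h.pos).1 hz).1
    have hc' := ((mem_triangle_iff h'.pos).1 hz').1
    exact sub_eq_zero.2
      ((h'.edgeForm_le_of_inCone h hc').antisymm (h.edgeForm_le_of_inCone h' hc))

lemma exists_combination (hP : IsPolygon b P V) {t u v : E} (h : IsEdge b V t u)
    (h' : IsEdge b V u v) {y : E →ₗ[ℝ] ℝ} (ht : y u ≤ y t) (hv : y u ≤ y v) :
    ∃ r s : ℝ, 0 ≤ r ∧ 0 ≤ s ∧ r + s = -y u ∧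
      y = r • -edgeForm b t u + s • -edgeForm b u v := by
  have hnext : 0 < 1 - edgeForm b t u v := sub_pos.2 (hP.edgeForm_next_lt h h')
  have hprev : 0 < 1 - edgeForm b u v t := sub_pos.2 (hP.edgeForm_prev_lt h h')
  set r : ℝ := (y v - y u) / (1 - edgeForm b t u v)
  have hrv : r * (1 - edgeForm b t u v) = y v - y u := div_mul_cancel₀ _ hnext.ne'
  have heq : y = r • -edgeForm b t u + (-y u - r) • -edgeForm b u v := by
    refine linearMap_eq_of_cross_pos h'.pos ?_ ?_ <;>
      simp only [LinearMap.add_apply, LinearMap.smul_apply, LinearMap.neg_apply, smul_eq_mul,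
        edgeForm_right h.pos, edgeForm_left h'.pos, edgeForm_right h'.pos] <;> linarith
  refine ⟨r, -y u - r, div_nonneg (sub_nonneg.2 hv) hnext.le, ?_, by ring, heq⟩
  have hst : (-y u - r) * (1 - edgeForm b u v t) = y t - y u := by
    have := LinearMap.congr_fun heq t
    simp only [LinearMap.add_apply, LinearMap.smul_apply, LinearMap.neg_apply, smul_eq_mul,
      edgeForm_left h.pos] at this
    linarith
  exact nonneg_of_mul_nonneg_left (hst ▸ sub_nonneg.2 ht) hprev

lemma inCone_of_edgeForm_eq_one (hP : IsPolygon b P V) {u v x : E} (h : IsEdge b V u v)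
    (hx : x ∈ P) (hx1 : edgeForm b u v x = 1) : InCone b u v x :=
  hP.inCone_of_forall_le h fun _ _ h' => (hP.edgeForm_le_of_mem h' hx).trans hx1.ge

lemma eq_zero_of_forall_nonpos (hP : IsPolygon b P V) {f : E →ₗ[ℝ] ℝ}
    (hf : ∀ u ∈ V, f u ≤ 0) : f = 0 := by
  have hnonpos : ∀ x, f x ≤ 0 := by
    intro x
    obtain ⟨u, v, h, hx⟩ := hP.exists_inCone x
    refine nonpos_of_mul_nonpos_right ?_ h.pos
    rw [cross_mul_map]
    exact add_nonpos (mul_nonpos_of_nonneg_of_nonpos hx.2 (hf u h.left_mem))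
      (mul_nonpos_of_nonneg_of_nonpos hx.1 (hf v h.right_mem))
  ext x
  have hneg := hnonpos (-x)
  rw [map_neg, neg_nonpos] at hneg
  exact (hnonpos x).antisymm hneg

open Classical in
lemma sum_edges_ite_cone {M : Type*} [AddCommMonoid M] (hP : IsPolygon b P V)
    {u v n : E} (h : IsEdge b V u v) (hn : InCone b u v n) (f : E × E → M) :
    ∑ σ ∈ edges b V, (if 0 < cross b σ.1 n ∧ 0 < cross b n σ.2 then f σ else 0) =
      if 0 < cross b u n ∧ 0 < cross b n v then f (u, v) else 0 := by
  refine Finset.sum_eq_single (u, v) (fun τ hτ hne => if_neg fun ⟨hτn, hnτ⟩ => hne ?_)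
    fun hnot => absurd (mem_edges.2 h) hnot
  obtain ⟨hfst, hsnd⟩ := hP.eq_of_inCone_of_pos (mem_edges.1 hτ) h hτn hnτ hn
  exact Prod.ext hfst hsnd

end IsPolygon

end Polygon

section Lattice

variable {E : Type*} [AddCommGroup E] [Module ℝ E] {b : Basis (Fin 2) ℝ E} {u v w n : E}

lemma mem_span_iff_exists_coord :
    n ∈ Submodule.span ℤ (Set.range b) ↔ ∃ i j : ℤ, b.coord 0 n = i ∧ b.coord 1 n = j := by
  rw [Basis.mem_span_iff_repr_mem, Fin.forall_fin_two]
  simp only [Set.mem_range, algebraMap_int_eq, eq_intCast, exists_and_left, exists_and_right,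
    Basis.coord_apply, eq_comm]

lemma exists_int_cross_eq (hu : u ∈ Submodule.span ℤ (Set.range b))
    (hv : v ∈ Submodule.span ℤ (Set.range b)) : ∃ k : ℤ, cross b u v = k := by
  obtain ⟨p, q, hp, hq⟩ := mem_span_iff_exists_coord.1 hu
  obtain ⟨p', q', hp', hq'⟩ := mem_span_iff_exists_coord.1 hv
  refine ⟨p * q' - q * p', ?_⟩
  rw [cross_apply, hp, hq, hp', hq']
  push_cast
  rfl

lemma exists_eq_intCast_smul_add (hu : u ∈ Submodule.span ℤ (Set.range b))
    (hw : w ∈ Submodule.span ℤ (Set.range b)) (huw : cross b u w = 1)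
    (hn : n ∈ Submodule.span ℤ (Set.range b)) :
    ∃ i j : ℤ, n = (i : ℝ) • u + (j : ℝ) • w := by
  obtain ⟨i, hi⟩ := exists_int_cross_eq hn hw
  obtain ⟨j, hj⟩ := exists_int_cross_eq hu hn
  exact ⟨i, j, by rw [← hi, ← hj, ← cross_smul_eq, huw, one_smul]⟩

lemma intCast_smul_add_mem {N : Submodule ℤ E} (hu : u ∈ N) (hw : w ∈ N) (i j : ℤ) :
    (i : ℝ) • u + (j : ℝ) • w ∈ N := by
  rw [Int.cast_smul_eq_zsmul, Int.cast_smul_eq_zsmul]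
  exact add_mem (N.smul_mem i hu) (N.smul_mem j hw)

lemma cross_left_smul_add_smul (huw : cross b u w = 1) (i j : ℝ) :
    cross b u (i • u + j • w) = j := by
  simp only [map_add, map_smul, cross_self, huw, smul_eq_mul, mul_zero, mul_one, zero_add]

lemma cross_smul_add_smul (huw : cross b u w = 1) (i j h d : ℝ) :
    cross b (i • u + j • w) (h • u + d • w) = i * d - j * h := by
  simp only [map_add, map_smul, LinearMap.add_apply, LinearMap.smul_apply, cross_self, huw,
    cross_swap b w u, smul_eq_mul]
  ring

end Lattice

section Primitive

variable {E : Type*} [NormedAddCommGroup E] [NormedSpace ℝ E]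

lemma IsPrimitive.isCoprime {N : Submodule ℤ E} {u x y : E} (hu : IsPrimitive N u) (hx : x ∈ N)
    (hy : y ∈ N) {p q : ℤ} (h : u = (p : ℝ) • x + (q : ℝ) • y) : IsCoprime p q := by
  have hunit := hu.2.2 ((p / Int.gcd p q) • x + (q / Int.gcd p q) • y)
    (add_mem (N.smul_mem _ hx) (N.smul_mem _ hy)) (Int.gcd p q) (by
      rw [smul_add, smul_smul, smul_smul, Int.mul_ediv_cancel' (Int.gcd_dvd_left _ _),
        Int.mul_ediv_cancel' (Int.gcd_dvd_right _ _), h, Int.cast_smul_eq_zsmul,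
        Int.cast_smul_eq_zsmul])
  rw [Int.isCoprime_iff_gcd_eq_one]
  simpa using Int.isUnit_iff_natAbs_eq.1 hunit

variable {b : Basis (Fin 2) ℝ E} {u v : E}

lemma IsPrimitive.exists_isCoprime_coord (hu : IsPrimitive (Submodule.span ℤ (Set.range b)) u) :
    ∃ p q : ℤ, IsCoprime p q ∧ b.coord 0 u = p ∧ b.coord 1 u = q := by
  obtain ⟨p, q, hp, hq⟩ := mem_span_iff_exists_coord.1 hu.1
  refine ⟨p, q, hu.isCoprime (Submodule.subset_span ⟨0, rfl⟩) (Submodule.subset_span ⟨1, rfl⟩) ?_,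
    hp, hq⟩
  rw [← hp, ← hq, Basis.coord_apply, Basis.coord_apply, ← Fin.sum_univ_two (fun i => _ • b i),
    b.sum_repr]

lemma IsPrimitive.exists_cross_eq_one (hu : IsPrimitive (Submodule.span ℤ (Set.range b)) u) :
    ∃ w ∈ Submodule.span ℤ (Set.range b), cross b u w = 1 := by
  obtain ⟨p, q, ⟨α, β, hαβ⟩, hp, hq⟩ := hu.exists_isCoprime_coord
  refine ⟨((-β : ℤ) : ℝ) • b 0 + (α : ℝ) • b 1,
    intCast_smul_add_mem (Submodule.subset_span (Set.mem_range_self 0))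
      (Submodule.subset_span (Set.mem_range_self 1)) _ _, ?_⟩
  have hR : (α : ℝ) * p + β * q = 1 := by exact_mod_cast hαβ
  simp only [cross_apply, hp, hq, map_add, map_smul, Basis.coord_apply, Basis.repr_self,
    Finsupp.single_apply, smul_eq_mul, Fin.isValue, one_ne_zero, zero_ne_one, if_true, if_false]
  push_cast
  linarith

lemma IsPrimitive.exists_int_of_smul_mem (hu : IsPrimitive (Submodule.span ℤ (Set.range b)) u)
    {c : ℝ} (hc : c • u ∈ Submodule.span ℤ (Set.range b)) : ∃ k : ℤ, c = k := by
  obtain ⟨w, hw, huw⟩ := hu.exists_cross_eq_one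
  obtain ⟨k, hk⟩ := exists_int_cross_eq hc hw
  rw [map_smul, LinearMap.smul_apply, huw, smul_eq_mul, mul_one] at hk
  exact ⟨k, hk⟩

lemma exists_normal_form (hu : IsPrimitive (Submodule.span ℤ (Set.range b)) u)
    (hv : IsPrimitive (Submodule.span ℤ (Set.range b)) v) (huv : 0 < cross b u v) :
    ∃ w ∈ Submodule.span ℤ (Set.range b), ∃ h d : ℤ, cross b u w = 1 ∧ 0 < d ∧ IsCoprime h d ∧
      v = (h : ℝ) • u + (d : ℝ) • w := by
  obtain ⟨w, hw, huw⟩ := hu.exists_cross_eq_one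
  obtain ⟨h, d, rfl⟩ := exists_eq_intCast_smul_add hu.1 hw huw hv.1
  rw [cross_left_smul_add_smul huw] at huv
  exact ⟨w, hw, h, d, huw, by exact_mod_cast huv, hv.isCoprime hu.1 hw rfl, rfl⟩

end Primitive

section TriangleSum

variable {E : Type*} [AddCommGroup E] [Module ℝ E] {b : Basis (Fin 2) ℝ E} {u w : E}
  {h d : ℤ}

lemma pos_and_pos_and_add_le_iff {i j : ℤ} (hd : 0 < d) :
    0 < j ∧ 0 < i * d - j * h ∧ j + (i * d - j * h) ≤ d ↔
      j ∈ Finset.Ioo 0 d ∧ j ≤ h * j % d ∧ i = h * j / d + 1 := by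
  have hdiv : d * (h * j / d) + h * j % d = h * j := Int.mul_ediv_add_emod _ _
  have hmod : 0 ≤ h * j % d := Int.emod_nonneg _ hd.ne'
  have hmod' : h * j % d < d := Int.emod_lt_of_pos _ hd
  rw [Finset.mem_Ioo]
  constructor
  · rintro ⟨hj, hpos, hle⟩
    have hlow : h * j / d < i := lt_of_mul_lt_mul_left (by linarith) hd.le
    have hupp : i < h * j / d + 2 := lt_of_mul_lt_mul_left (by linarith) hd.le
    obtain rfl : i = h * j / d + 1 := by omega
    exact ⟨⟨hj, by linarith⟩, by linarith, rfl⟩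
  · rintro ⟨⟨hj, -⟩, hle, rfl⟩
    exact ⟨hj, by linarith, by linarith⟩

lemma edgeForm_smul_add_smul (huw : cross b u w = 1) (i j h d : ℝ) :
    edgeForm b u (h • u + d • w) (i • u + j • w) = (j + (i * d - j * h)) / d := by
  rw [edgeForm_apply, cross_left_smul_add_smul huw, cross_left_smul_add_smul huw,
    cross_smul_add_smul huw]

lemma one_sub_edgeForm_eq (huw : cross b u w = 1) (hd : 0 < d) (j : ℤ) :
    1 - edgeForm b u ((h : ℝ) • u + (d : ℝ) • w) (((h * j / d + 1 : ℤ) : ℝ) • u + (j : ℝ) • w) =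
      ((h * j % d : ℤ) - j : ℝ) / d := by
  have hdR : (d : ℝ) ≠ 0 := by exact_mod_cast hd.ne'
  have hdiv : (d : ℝ) * (h * j / d : ℤ) + (h * j % d : ℤ) = h * j := by
    exact_mod_cast Int.mul_ediv_add_emod (h * j) d
  rw [edgeForm_smul_add_smul huw, one_sub_div hdR]
  congr 1
  push_cast
  linear_combination -hdiv

lemma mem_triangle_intCast_iff (huw : cross b u w = 1) (hd : 0 < d) {i j : ℤ} :
    (0 < cross b u ((i : ℝ) • u + (j : ℝ) • w) ∧
      0 < cross b ((i : ℝ) • u + (j : ℝ) • w) ((h : ℝ) • u + (d : ℝ) • w) ∧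
      edgeForm b u ((h : ℝ) • u + (d : ℝ) • w) ((i : ℝ) • u + (j : ℝ) • w) ≤ 1) ↔
    j ∈ Finset.Ioo 0 d ∧ j ≤ h * j % d ∧ i = h * j / d + 1 := by
  rw [← pos_and_pos_and_add_le_iff hd, edgeForm_smul_add_smul huw,
    cross_left_smul_add_smul huw, cross_smul_add_smul huw,
    div_le_one (by exact_mod_cast hd)]
  norm_cast

lemma sum_triangle_eq (hu : u ∈ Submodule.span ℤ (Set.range b))
    (hw : w ∈ Submodule.span ℤ (Set.range b)) (huw : cross b u w = 1) (hd : 0 < d) {v : E}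
    (hv : v = (h : ℝ) • u + (d : ℝ) • w) {T : Finset E}
    (hT : ∀ n, n ∈ T ↔ n ∈ Submodule.span ℤ (Set.range b) ∧
      0 < cross b u n ∧ 0 < cross b n v ∧ edgeForm b u v n ≤ 1) :
    ∑ n ∈ T, (1 - edgeForm b u v n) ^ 2 =
      ∑ j ∈ Finset.Ioo 0 d with j ≤ h * j % d, (((h * j % d : ℤ) - j : ℝ) / d) ^ 2 := by
  subst hv
  symm
  refine Finset.sum_nbij
    (fun j : ℤ => ((h * j / d + 1 : ℤ) : ℝ) • u + (j : ℝ) • w) ?_ ?_ ?_ ?_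
  · intro j hj
    rw [Finset.mem_filter] at hj
    exact (hT _).2 ⟨intCast_smul_add_mem hu hw _ _,
      (mem_triangle_intCast_iff huw hd).2 ⟨hj.1, hj.2, rfl⟩⟩
  · intro j _ j' _ hjj'
    have hcross := congrArg (cross b u) hjj'
    simp only [cross_left_smul_add_smul huw] at hcross
    exact_mod_cast hcross
  · intro n hn
    obtain ⟨hnL, hn⟩ := (hT n).1 hn
    obtain ⟨i, j, rfl⟩ := exists_eq_intCast_smul_add hu hw huw hnL
    obtain ⟨hj, hle, rfl⟩ := (mem_triangle_intCast_iff huw hd).1 hn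
    exact ⟨j, Finset.mem_filter.2 ⟨hj, hle⟩, rfl⟩
  · exact fun j _ => by rw [one_sub_edgeForm_eq huw hd]

end TriangleSum

section CrossingEdges

variable {E : Type*} [AddCommGroup E] [Module ℝ E] {b : Basis (Fin 2) ℝ E} {P : Set E}
  {V : Finset E} {e : E}

namespace IsPolygon

lemma sum_crossing_eq_one (hP : IsPolygon b P V) (he : ∀ u ∈ V, cross b e u ≠ 0) :
    ∑ σ ∈ edges b V, (if cross b e σ.1 < 0 ∧ 0 < cross b e σ.2 then (1 : ℝ) else 0) = 1 := by
  obtain ⟨u, v, h, hc⟩ := hP.exists_inCone e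
  have hu : cross b e u < 0 := by
    refine lt_of_le_of_ne ?_ (he u h.left_mem)
    rw [cross_swap]
    exact neg_nonpos.2 hc.1
  have hv : 0 < cross b e v := lt_of_le_of_ne hc.2 (he v h.right_mem).symm
  rw [Finset.sum_eq_single_of_mem (u, v) (mem_edges.2 h), if_pos ⟨hu, hv⟩]
  rintro σ hσ hne
  refine if_neg fun ⟨hσu, hσv⟩ => hne ?_
  rw [cross_swap] at hσu
  obtain ⟨h1, h2⟩ := hP.eq_of_inCone_of_pos (mem_edges.1 hσ) h (neg_neg_iff_pos.1 hσu) hσv hc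
  exact Prod.ext h1 h2

lemma sum_one_sub_sign (hP : IsPolygon b P V) (he : ∀ u ∈ V, cross b e u ≠ 0) :
    ∑ σ ∈ edges b V, (1 - SignType.sign (cross b e σ.1 * cross b e σ.2) : ℝ) = 4 := by
  have hpt : ∀ σ ∈ edges b V, (1 - SignType.sign (cross b e σ.1 * cross b e σ.2) : ℝ) =
      2 * (if cross b e σ.1 < 0 ∧ 0 < cross b e σ.2 then 1 else 0) +
        2 * (if cross b (-e) σ.1 < 0 ∧ 0 < cross b (-e) σ.2 then 1 else 0) := by
    intro σ hσ
    have h := mem_edges.1 hσ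
    simp only [map_neg, LinearMap.neg_apply, neg_neg_iff_pos, Left.neg_pos_iff, sign_mul]
    rcases lt_or_gt_of_ne (he _ h.left_mem) with hu | hu <;>
      rcases lt_or_gt_of_ne (he _ h.right_mem) with hv | hv <;>
      norm_num [hu, hv, hu.not_gt, hv.not_gt]
  rw [Finset.sum_congr rfl hpt, Finset.sum_add_distrib, ← Finset.mul_sum, ← Finset.mul_sum,
    hP.sum_crossing_eq_one he, hP.sum_crossing_eq_one (e := -e) (by simpa using he)]
  norm_num

end IsPolygon

end CrossingEdges

lemma exists_basis_coord_one_ne_zero {E : Type*} [NormedAddCommGroup E] [NormedSpace ℝ E]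
    [FiniteDimensional ℝ E] (hE : finrank ℝ E = 2) (N : Submodule ℤ E) [DiscreteTopology N]
    [IsZLattice ℝ N] (V : Finset E) (hVN : ∀ u ∈ V, u ∈ N) (hV0 : ∀ u ∈ V, u ≠ 0) :
    ∃ b : Basis (Fin 2) ℝ E, N = Submodule.span ℤ (Set.range b) ∧
      ∀ u ∈ V, b.coord 1 u ≠ 0 := by
  have : Module.Finite ℤ N := ZLattice.module_finite ℝ N
  have : Module.Free ℤ N := ZLattice.module_free ℝ N
  let c := finBasisOfFinrankEq ℤ N ((ZLattice.rank ℝ N).trans hE)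
  obtain ⟨K, hK⟩ := ((V.finite_toSet.preimage Subtype.val_injective.injOn).image
    fun n : N => -c.coord 1 n / c.coord 0 n).exists_notMem
  have hshear : (K • c.coord 0) (c 1) = 0 := by simp
  let b := c.map (LinearEquiv.transvection hshear).symm
  refine ⟨b.ofZLatticeBasis ℝ N, (b.ofZLatticeBasis_span ℝ).symm, fun u hu => ?_⟩
  lift u to N using hVN u hu with n
  have hcoord : (b.ofZLatticeBasis ℝ N).coord 1 n = (c.coord 1 n + K * c.coord 0 n : ℤ) := by
    rw [Basis.coord_apply, b.ofZLatticeBasis_repr_apply ℝ N n 1]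
    simp [b, LinearMap.transvection.apply]
  rw [hcoord, Int.cast_ne_zero]
  intro h0
  by_cases hp : c.coord 0 n = 0
  · rw [hp, mul_zero, add_zero] at h0
    have hn : n = 0 := c.forall_coord_eq_zero_iff.1 (Fin.forall_fin_two.2 ⟨hp, h0⟩)
    exact hV0 n hu (by rw [hn, ZeroMemClass.coe_zero])
  · exact hK ⟨n, hu, Int.ediv_eq_of_eq_mul_left hp (by linarith)⟩

section Potential

/-- The function of the vertices whose differences along the edges of a polygon are, up to the
signs of the three-term law, the Dedekind sums of the edges. For a lattice vector the floors are
just its integer coordinates. -/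
noncomputable def dedekindPotential {E : Type*} [AddCommGroup E] [Module ℝ E]
    (b : Basis (Fin 2) ℝ E) (u : E) : ℝ :=
  12 * dedekindSum ⌊b.coord 0 u⌋ ⌊b.coord 1 u⌋ - b.coord 0 u / b.coord 1 u

variable {E : Type*} [NormedAddCommGroup E] [NormedSpace ℝ E] {b : Basis (Fin 2) ℝ E}

lemma twelve_mul_sum_triangle {u v : E} (hu : IsPrimitive (Submodule.span ℤ (Set.range b)) u)
    (hv : IsPrimitive (Submodule.span ℤ (Set.range b)) v) (huv : 0 < cross b u v)
    (hu0 : b.coord 1 u ≠ 0) (hv0 : b.coord 1 v ≠ 0) {T : Finset E}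
    (hT : ∀ n, n ∈ T ↔ n ∈ Submodule.span ℤ (Set.range b) ∧
      0 < cross b u n ∧ 0 < cross b n v ∧ edgeForm b u v n ≤ 1) :
    12 * ∑ n ∈ T, (1 - edgeForm b u v n) ^ 2 = cross b u v +
      ((1 - b.coord 1 u / b.coord 1 v) / cross b u v +
        (1 - b.coord 1 v / b.coord 1 u) / cross b u v) -
      3 * (1 - SignType.sign (b.coord 1 u * b.coord 1 v) : ℝ) +
      (dedekindPotential b u - dedekindPotential b v) := by
  obtain ⟨w, hw, h, d, huw, hd, hhd, hv_eq⟩ := exists_normal_form hu hv huv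
  have hcross : cross b u v = d := by rw [hv_eq, cross_left_smul_add_smul huw]
  obtain ⟨p, q, -, hp, hq⟩ := hu.exists_isCoprime_coord
  obtain ⟨p', q', hpq', hp', hq'⟩ := hv.exists_isCoprime_coord
  obtain ⟨x, y, hx, hy⟩ := mem_span_iff_exists_coord.1 hw
  have hp'_eq : p' = h * p + d * x := by
    have := congrArg (b.coord 0) hv_eq
    simp only [map_add, map_smul, smul_eq_mul, hp, hp', hx] at this
    exact_mod_cast this
  have hq'_eq : q' = h * q + d * y := by
    have := congrArg (b.coord 1) hv_eq
    simp only [map_add, map_smul, smul_eq_mul, hq, hq', hy] at this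
    exact_mod_cast this
  have hdetR : (p : ℝ) * q' - q * p' = d := by rw [← hcross, cross_apply, hp, hq, hp', hq']
  rw [hq] at hu0
  rw [hq'] at hv0
  have hlaw := dedekindSum_three_term hpq' (by exact_mod_cast hv0) (by exact_mod_cast hdetR) hd
    (k := h) ⟨x, by linarith⟩ ⟨y, by linarith⟩
  have hd0 : (d : ℝ) ≠ 0 := by exact_mod_cast hd.ne'
  have hsign : ((q * q' * d).sign : ℝ) = SignType.sign ((q : ℝ) * q') := by
    rw [Int.sign_mul, Int.sign_eq_one_of_pos hd, mul_one, Int.sign_eq_sign]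
    rcases lt_or_gt_of_ne (mul_ne_zero hu0 hv0) with hneg | hpos
    · rw [sign_neg hneg, sign_neg (by exact_mod_cast hneg)]
      simp
    · rw [sign_pos hpos, sign_pos (by exact_mod_cast hpos)]
      simp
  rw [sum_triangle_eq hu.1 hw huw hd hv_eq hT, sum_filter_le_mul_emod_sub_sq hd hhd, hlaw,
    dedekindCocycle, hsign, hcross, dedekindPotential, dedekindPotential, hp, hq, hp', hq']
  simp only [Int.floor_intCast]
  field_simp
  linear_combination (4 * (d : ℝ)) * hdetR

end Potential

section DualArea

variable {E : Type*} [AddCommGroup E] [Module ℝ E] {b : Basis (Fin 2) ℝ E} {P : Set E}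
  {V : Finset E}

/-- Twice the area of the triangle in the dual polygon that corresponds to the vertex `u` with
neighbours `t` and `v`. -/
noncomputable def dualArea (b : Basis (Fin 2) ℝ E) (t u v : E) : ℝ :=
  cross b (t - u) (u - v) / (cross b t u * cross b u v)

lemma dualArea_nonneg {t u v : E} (h : IsEdge b V t u) (h' : IsEdge b V u v) :
    0 ≤ dualArea b t u v := by
  refine div_nonneg ?_ (mul_pos h.pos h'.pos).le
  have hle := h.cross_add_le v h'.right_mem
  have hswap := cross_swap b v u
  simp only [map_sub, LinearMap.sub_apply, cross_self]
  linarith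

lemma dualArea_eq {t u v : E} (htu : 0 < cross b t u) (huv : 0 < cross b u v)
    (hu : b.coord 1 u ≠ 0) :
    dualArea b t u v = (1 - b.coord 1 t / b.coord 1 u) / cross b t u +
      (1 - b.coord 1 v / b.coord 1 u) / cross b u v := by
  have hplucker : cross b t v * b.coord 1 u =
      cross b u v * b.coord 1 t + cross b t u * b.coord 1 v := by
    simp only [cross_apply]; ring
  simp only [dualArea, map_sub, LinearMap.sub_apply, cross_self]
  field_simp
  linear_combination -hplucker

lemma IsPolygon.sum_dualArea (hP : IsPolygon b P V) (hV : ∀ u ∈ V, b.coord 1 u ≠ 0)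
    {next : E → E} (hnext : ∀ u ∈ V, IsEdge b V u (next u)) :
    ∑ σ ∈ edges b V, dualArea b σ.1 σ.2 (next σ.2) =
      ∑ σ ∈ edges b V, ((1 - b.coord 1 σ.1 / b.coord 1 σ.2) / cross b σ.1 σ.2 +
        (1 - b.coord 1 σ.2 / b.coord 1 σ.1) / cross b σ.1 σ.2) := by
  have hterm : ∀ σ ∈ edges b V, dualArea b σ.1 σ.2 (next σ.2) =
      (1 - b.coord 1 σ.1 / b.coord 1 σ.2) / cross b σ.1 σ.2 +
        (1 - b.coord 1 (next σ.2) / b.coord 1 σ.2) / cross b σ.2 (next σ.2) := fun σ hσ =>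
    have h := mem_edges.1 hσ
    dualArea_eq h.pos (hnext _ h.right_mem).pos (hV _ h.right_mem)
  rw [Finset.sum_congr rfl hterm, Finset.sum_add_distrib, Finset.sum_add_distrib,
    hP.sum_edges_snd fun u => (1 - b.coord 1 (next u) / b.coord 1 u) / cross b u (next u),
    ← hP.sum_edges_fst]
  congr 1
  refine Finset.sum_congr rfl fun σ hσ => ?_
  rw [hP.right_unique (hnext _ (mem_edges.1 hσ).left_mem) (mem_edges.1 hσ)]

end DualArea

section EdgeSum

variable {E : Type*} [AddCommGroup E] [Module ℝ E] {b : Basis (Fin 2) ℝ E} {P : Set E}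
  {V A : Finset E} {u v w : E}

open Classical in
/-- The contribution of the points of `A` in the open cone over the edge `u`, `v` to the sum
`∑ n ∈ A, (κ n + 1) ^ 2`, where `κ = -edgeForm b u v` on that cone. -/
noncomputable def edgeSum (b : Basis (Fin 2) ℝ E) (A : Finset E) (u v : E) : ℝ :=
  ∑ n ∈ A with 0 < cross b u n ∧ 0 < cross b n v, (1 - edgeForm b u v n) ^ 2

lemma edgeSum_nonneg (A : Finset E) (u v : E) : 0 ≤ edgeSum b A u v :=
  Finset.sum_nonneg fun _ _ => sq_nonneg _

namespace IsPolygon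

lemma mem_filter_cone_iff (hP : IsPolygon b P V) {L : Submodule ℤ E}
    (hA : ∀ n, n ∈ A ↔ n ∈ P ∧ n ∈ L) {u v : E} (h : IsEdge b V u v)
    [DecidablePred fun n => 0 < cross b u n ∧ 0 < cross b n v] (n : E) :
    n ∈ A.filter (fun n => 0 < cross b u n ∧ 0 < cross b n v) ↔
      n ∈ L ∧ 0 < cross b u n ∧ 0 < cross b n v ∧ edgeForm b u v n ≤ 1 := by
  rw [Finset.mem_filter, hA]
  constructor
  · rintro ⟨⟨hnP, hnL⟩, hu, hv⟩
    exact ⟨hnL, hu, hv, hP.edgeForm_le_of_mem h hnP⟩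
  · rintro ⟨hnL, hu, hv, hle⟩
    exact ⟨⟨hP.mem_of_inCone h ⟨hu.le, hv.le⟩ hle, hnL⟩, hu, hv⟩

lemma exists_edgeForm_smul_add_eq_one (hP : IsPolygon b P V)
    (hA : ∀ n, n ∈ A ↔ n ∈ P ∧ n ∈ Submodule.span ℤ (Set.range b)) (huv : IsEdge b V u v)
    (hzero : edgeSum b A u v = 0) (hu : u ∈ Submodule.span ℤ (Set.range b))
    (hw : w ∈ Submodule.span ℤ (Set.range b)) (huw : cross b u w = 1) {h d : ℤ} (hd : 0 < d)
    (hhd : IsCoprime h d) (hv : v = (h : ℝ) • u + (d : ℝ) • w) :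
    ∃ i : ℤ, edgeForm b u v ((i : ℝ) • u + w) = 1 := by
  rcases (show 1 ≤ d from hd).eq_or_lt with rfl | hd1
  · rw [Int.cast_one, one_smul] at hv
    exact ⟨h, hv ▸ edgeForm_right huv.pos⟩
  have hmod : 1 ≤ h * 1 % d := by
    rw [mul_one]
    refine (Int.emod_nonneg h hd.ne').lt_of_ne fun h0 => ?_
    have hunit : IsUnit d := hhd.isUnit_of_dvd' (Int.dvd_of_emod_eq_zero h0.symm) dvd_rfl
    rcases Int.isUnit_iff.1 hunit with h | h <;> omega
  have htriangle := (mem_triangle_intCast_iff huw hd).2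
    ⟨Finset.mem_Ioo.2 ⟨one_pos, hd1⟩, hmod, rfl⟩
  rw [← hv] at htriangle
  have hterm := (Finset.sum_eq_zero_iff_of_nonneg fun _ _ => sq_nonneg _).1 hzero _
    ((hP.mem_filter_cone_iff hA huv _).2 ⟨intCast_smul_add_mem hu hw _ _, htriangle⟩)
  refine ⟨h * 1 / d + 1, ?_⟩
  rw [Int.cast_one, one_smul] at hterm
  exact (sub_eq_zero.1 (sq_eq_zero_iff.1 hterm)).symm

end IsPolygon

end EdgeSum

section Noether

variable {E : Type*} [NormedAddCommGroup E] [NormedSpace ℝ E] {b : Basis (Fin 2) ℝ E} {P : Set E}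
  {V A : Finset E}

theorem IsPolygon.sum_cross_add_sum_dualArea (hP : IsPolygon b P V)
    (hprim : ∀ u ∈ V, IsPrimitive (Submodule.span ℤ (Set.range b)) u)
    (hV : ∀ u ∈ V, b.coord 1 u ≠ 0)
    (hA : ∀ n, n ∈ A ↔ n ∈ P ∧ n ∈ Submodule.span ℤ (Set.range b))
    {next : E → E} (hnext : ∀ u ∈ V, IsEdge b V u (next u)) :
    ∑ σ ∈ edges b V, cross b σ.1 σ.2 + ∑ σ ∈ edges b V, dualArea b σ.1 σ.2 (next σ.2) =
      12 * (1 + ∑ σ ∈ edges b V, edgeSum b A σ.1 σ.2) := by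
  have hcross (u : E) : cross b (b 0) u = b.coord 1 u := by simp [cross_apply]
  have hsign := hP.sum_one_sub_sign (e := b 0) (by simpa only [hcross] using hV)
  simp only [hcross] at hsign
  have hedge : ∀ σ ∈ edges b V, 12 * edgeSum b A σ.1 σ.2 = _ := fun σ hσ =>
    have h := mem_edges.1 hσ
    twelve_mul_sum_triangle (hprim _ h.left_mem) (hprim _ h.right_mem) h.pos (hV _ h.left_mem)
      (hV _ h.right_mem) (hP.mem_filter_cone_iff hA h)
  have htelescope : ∑ σ ∈ edges b V, (dedekindPotential b σ.1 - dedekindPotential b σ.2) = 0 := by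
    rw [Finset.sum_sub_distrib, hP.sum_edges_fst, hP.sum_edges_snd, sub_self]
  rw [mul_add, Finset.mul_sum, Finset.sum_congr rfl hedge, Finset.sum_add_distrib, htelescope,
    Finset.sum_sub_distrib, ← Finset.mul_sum, hsign, Finset.sum_add_distrib,
    hP.sum_dualArea hV hnext]
  ring

end Noether

section Measure

lemma isCompact_triangle {E : Type*} [NormedAddCommGroup E] [NormedSpace ℝ E] (x y : E) :
    IsCompact (convexHull ℝ {0, x, y}) :=
  (Set.toFinite _).isCompact_convexHull ℝ

lemma mem_triangle_basis_iff {E : Type*} [AddCommGroup E] [Module ℝ E] (b : Basis (Fin 2) ℝ E)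
    {z : E} : z ∈ convexHull ℝ {0, b 0, b 1} ↔
      0 ≤ b.coord 0 z ∧ 0 ≤ b.coord 1 z ∧ b.coord 0 z + b.coord 1 z ≤ 1 := by
  rw [mem_convexHull_triangle]
  constructor
  · rintro ⟨s, t, hs, ht, hst, rfl⟩
    simpa using ⟨hs, ht, hst⟩
  · rintro ⟨h₀, h₁, hle⟩
    refine ⟨_, _, h₀, h₁, hle, ?_⟩
    conv_lhs => rw [← b.sum_repr z, Fin.sum_univ_two]
    rfl

lemma mem_reflected_triangle_basis_iff {E : Type*} [AddCommGroup E] [Module ℝ E]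
    (b : Basis (Fin 2) ℝ E) {z : E} : b 0 + b 1 - z ∈ convexHull ℝ {0, b 0, b 1} ↔
      b.coord 0 z ≤ 1 ∧ b.coord 1 z ≤ 1 ∧ 1 ≤ b.coord 0 z + b.coord 1 z := by
  have h₀ : b.coord 0 (b 0 + b 1 - z) = 1 - b.coord 0 z := by simp
  have h₁ : b.coord 1 (b 0 + b 1 - z) = 1 - b.coord 1 z := by simp
  rw [mem_triangle_basis_iff, h₀, h₁, sub_nonneg, sub_nonneg]
  refine and_congr_right' (and_congr_right' ?_)
  constructor <;> intro h <;> linarith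

lemma parallelepiped_eq_union_triangle {E : Type*} [AddCommGroup E] [Module ℝ E]
    (b : Basis (Fin 2) ℝ E) : parallelepiped b =
      convexHull ℝ {0, b 0, b 1} ∪ (b 0 + b 1 - ·) ⁻¹' convexHull ℝ {0, b 0, b 1} := by
  ext z
  rw [parallelepiped_basis_eq, Set.mem_union, Set.mem_preimage, mem_triangle_basis_iff,
    mem_reflected_triangle_basis_iff]
  simp only [Set.mem_ofPred_eq, Fin.forall_fin_two, Set.mem_Icc, Basis.coord_apply]
  constructor
  · rintro ⟨⟨h₀, h₀'⟩, h₁, h₁'⟩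
    exact (le_total (b.repr z 0 + b.repr z 1) 1).imp (⟨h₀, h₁, ·⟩) (⟨h₀', h₁', ·⟩)
  · rintro (⟨h₀, h₁, h⟩ | ⟨h₀, h₁, h⟩) <;> refine ⟨⟨?_, ?_⟩, ?_, ?_⟩ <;> linarith

variable {E : Type*} [NormedAddCommGroup E] [NormedSpace ℝ E] [FiniteDimensional ℝ E]
  [MeasurableSpace E] [BorelSpace E] (μ : Measure E) [μ.IsAddHaarMeasure]

lemma measure_ker_eq_zero {f : E →ₗ[ℝ] ℝ} (hf : f ≠ 0) : μ {x | f x = 0} = 0 :=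
  Measure.addHaar_submodule μ (LinearMap.ker f) fun h => hf (LinearMap.ker_eq_top.1 h)

lemma measure_level_eq_zero {f : E →ₗ[ℝ] ℝ} (hf : f ≠ 0) (c : ℝ) : μ {x | f x = c} = 0 := by
  obtain ⟨x₀, rfl⟩ := LinearMap.surjective hf c
  have htranslate : {x | f x = f x₀} = (· + -x₀) ⁻¹' {x | f x = 0} := by
    ext x
    simp [← sub_eq_add_neg, sub_eq_zero]
  rw [htranslate, measure_preimage_add_right, measure_ker_eq_zero μ hf]

variable (b : Basis (Fin 2) ℝ E)

lemma measureReal_triangle_basis :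
    μ.real (convexHull ℝ {0, b 0, b 1}) = μ.real (ZSpan.fundamentalDomain b) / 2 := by
  have hT := (isCompact_triangle (b 0) (b 1)).isClosed.measurableSet.nullMeasurableSet (μ := μ)
  have hfin := (isCompact_triangle (b 0) (b 1)).measure_ne_top (μ := μ)
  have hreflect := Measure.measurePreserving_sub_left μ (b 0 + b 1)
  have hne : b.coord 0 + b.coord 1 ≠ 0 := fun h => by simpa using LinearMap.congr_fun h (b 0)
  have hdisj : AEDisjoint μ (convexHull ℝ {0, b 0, b 1})
      ((b 0 + b 1 - ·) ⁻¹' convexHull ℝ {0, b 0, b 1}) :=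
    measure_mono_null (fun z hz => le_antisymm ((mem_triangle_basis_iff b).1 hz.1).2.2
      ((mem_reflected_triangle_basis_iff b).1 hz.2).2.2) (measure_level_eq_zero μ hne 1)
  rw [eq_div_iff two_ne_zero, mul_two, eq_comm, measureReal_def,
    measure_congr (ZSpan.fundamentalDomain_ae_parallelepiped b μ),
    parallelepiped_eq_union_triangle,
    measure_union₀ (hT.preimage hreflect.quasiMeasurePreserving) hdisj,
    hreflect.measure_preimage hT, ENNReal.toReal_add hfin hfin]
  rfl

lemma measureReal_triangle (x y : E) :
    μ.real (convexHull ℝ {0, x, y}) =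
      |cross b x y| / 2 * μ.real (ZSpan.fundamentalDomain b) := by
  set f : E →ₗ[ℝ] E := b.constr ℝ ![x, y] with hf
  have hf₀ : f (b 0) = x := by simp [hf]
  have hf₁ : f (b 1) = y := by simp [hf]
  have himage : convexHull ℝ {0, x, y} = f '' convexHull ℝ {0, b 0, b 1} := by
    rw [f.image_convexHull, Set.image_insert_eq, Set.image_pair, map_zero, hf₀, hf₁]
  have hdet : LinearMap.det f = cross b x y := by
    rw [← LinearMap.det_toMatrix b, Matrix.det_fin_two]
    simp only [LinearMap.toMatrix_apply, hf₀, hf₁, cross_apply, Basis.coord_apply]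
    ring
  rw [himage, measureReal_def, Measure.addHaar_image_linearMap, hdet, ENNReal.toReal_mul,
    ENNReal.toReal_ofReal (abs_nonneg _), ← measureReal_def, measureReal_triangle_basis]
  ring

lemma measureReal_biUnion_triangle {ι : Type*} {I : Finset ι} {x y : ι → E}
    (hdisj : ∀ i ∈ I, ∀ j ∈ I, i ≠ j → ∃ f : E →ₗ[ℝ] ℝ, f ≠ 0 ∧
      ∀ z ∈ convexHull ℝ {0, x i, y i}, z ∈ convexHull ℝ {0, x j, y j} → f z = 0) :
    μ.real (⋃ i ∈ I, convexHull ℝ {0, x i, y i}) =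
      (∑ i ∈ I, |cross b (x i) (y i)|) / 2 * μ.real (ZSpan.fundamentalDomain b) := by
  have hpairwise : (I : Set ι).Pairwise
      (Function.onFun (AEDisjoint μ) fun i => convexHull ℝ {0, x i, y i}) := by
    intro i hi j hj hij
    obtain ⟨f, hf, hz⟩ := hdisj i hi j hj hij
    exact measure_mono_null (fun z h => hz z h.1 h.2) (measure_ker_eq_zero μ hf)
  rw [measureReal_biUnion_finset₀ hpairwise
    (fun i _ => (isCompact_triangle _ _).isClosed.measurableSet.nullMeasurableSet)
    (fun i _ => (isCompact_triangle _ _).measure_ne_top), Finset.sum_div, Finset.sum_mul]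
  exact Finset.sum_congr rfl fun i _ => measureReal_triangle μ b (x i) (y i)

lemma normalizedVolume_biUnion_triangle {ι : Type*} {I : Finset ι} {x y : ι → E}
    (hdisj : ∀ i ∈ I, ∀ j ∈ I, i ≠ j → ∃ f : E →ₗ[ℝ] ℝ, f ≠ 0 ∧
      ∀ z ∈ convexHull ℝ {0, x i, y i}, z ∈ convexHull ℝ {0, x j, y j} → f z = 0) :
    normalizedVolume (Submodule.span ℤ (Set.range b)) (⋃ i ∈ I, convexHull ℝ {0, x i, y i}) =
      ∑ i ∈ I, |cross b (x i) (y i)| := by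
  have hcovolume := ZLattice.covolume_eq_measure_fundamentalDomain
    (Submodule.span ℤ (Set.range b)) Measure.addHaar (ZSpan.isAddFundamentalDomain b _)
  have hne : (Measure.addHaar : Measure E).real (ZSpan.fundamentalDomain b) ≠ 0 :=
    ENNReal.toReal_ne_zero.2 ⟨ZSpan.measure_fundamentalDomain_ne_zero b,
      (ZSpan.fundamentalDomain_isBounded b).measure_lt_top.ne⟩
  rw [normalizedVolume, finrank_eq_card_basis b, Fintype.card_fin, hcovolume,
    measureReal_biUnion_triangle _ b hdisj, mul_div_cancel_right₀ _ hne, Nat.factorial_two,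
    Nat.cast_two, mul_div_cancel₀ _ two_ne_zero]

end Measure

section Dual

lemma exists_cross_pos_of_ne_zero {E : Type*} [AddCommGroup E] [Module ℝ E]
    (b : Basis (Fin 2) ℝ E) {x : E} (hx : x ≠ 0) : ∃ y, 0 < cross b x y := by
  by_contra! hle
  have hrotate : cross b x (-b.coord 1 x • b 0 + b.coord 0 x • b 1) =
      b.coord 0 x ^ 2 + b.coord 1 x ^ 2 := by
    simp [cross_apply, sq]
  have hnonpos := hrotate ▸ hle _
  have h₀ : b.coord 0 x = 0 := by nlinarith
  have h₁ : b.coord 1 x = 0 := by nlinarith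
  exact hx (b.ext_elem fun i => by fin_cases i <;> simpa)

variable {E : Type*} [NormedAddCommGroup E] [NormedSpace ℝ E] {b : Basis (Fin 2) ℝ E}
  {P : Set E} {V : Finset E}

lemma IsPolygon.mem_dualPolytope_iff (hP : IsPolygon b P V) {y : StrongDual ℝ E} :
    y ∈ dualPolytope P ↔ ∀ u ∈ V, -1 ≤ y u := by
  refine ⟨fun h u hu => h u (hP.vertex_mem hu), fun h x hx => ?_⟩
  have hsubset : convexHull ℝ (V : Set E) ⊆ {x | -1 ≤ y x} :=
    convexHull_min h (convex_halfSpace_ge y.toLinearMap.isLinear (-1))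
  exact hsubset (hP.eq_hull ▸ hx)

variable [FiniteDimensional ℝ E]

/-- The vertex of the dual polygon that corresponds to the edge from `u` to `v`. -/
noncomputable def dualVertex (b : Basis (Fin 2) ℝ E) (u v : E) : StrongDual ℝ E :=
  LinearMap.toContinuousLinearMap (-edgeForm b u v)

lemma dualVertex_apply (u v x : E) : dualVertex b u v x = -edgeForm b u v x := rfl

/-- The basis dual to `b`, in the space of continuous linear forms. -/
noncomputable def strongDualBasis (b : Basis (Fin 2) ℝ E) : Basis (Fin 2) ℝ (StrongDual ℝ E) :=
  b.dualBasis.map LinearMap.toContinuousLinearMap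

lemma strongDualBasis_coord (i : Fin 2) (y : StrongDual ℝ E) :
    (strongDualBasis b).coord i y = y (b i) := by
  simp [strongDualBasis]

lemma dualLattice_eq_span : dualLattice (Submodule.span ℤ (Set.range b)) =
    Submodule.span ℤ (Set.range (strongDualBasis b)) := by
  ext y
  rw [mem_span_iff_exists_coord, strongDualBasis_coord, strongDualBasis_coord]
  constructor
  · intro h
    obtain ⟨k, hk⟩ := h (b 0) (Submodule.subset_span ⟨0, rfl⟩)
    obtain ⟨l, hl⟩ := h (b 1) (Submodule.subset_span ⟨1, rfl⟩)
    exact ⟨k, l, hk, hl⟩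
  · rintro ⟨k, l, hk, hl⟩ n hn
    obtain ⟨i, j, hi, hj⟩ := mem_span_iff_exists_coord.1 hn
    refine ⟨i * k + j * l, ?_⟩
    rw [← b.sum_repr n, Fin.sum_univ_two, map_add, map_smul, map_smul, hk, hl]
    simp only [Basis.coord_apply] at hi hj
    rw [hi, hj]
    push_cast
    rfl

lemma cross_dualVertex {t u v : E} (htu : 0 < cross b t u) (huv : 0 < cross b u v) :
    cross (strongDualBasis b) (dualVertex b t u) (dualVertex b u v) = dualArea b t u v := by
  have hne : cross b t u ≠ 0 := htu.ne'
  have hne' : cross b u v ≠ 0 := huv.ne'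
  simp only [cross_apply (strongDualBasis b), strongDualBasis_coord, dualVertex_apply,
    edgeForm_apply, dualArea]
  field_simp
  simp only [cross_apply, Basis.coord_apply, Basis.repr_self, ne_eq, one_ne_zero,
    not_false_eq_true, Finsupp.single_eq_of_ne, mul_zero, Finsupp.single_eq_same, mul_one, zero_sub,
    one_mul, zero_mul, sub_zero, zero_ne_one, map_sub, LinearMap.sub_apply]
  ring

namespace IsPolygon

lemma dualVertex_mem (hP : IsPolygon b P V) {u v : E} (h : IsEdge b V u v) :
    dualVertex b u v ∈ dualPolytope P :=
  fun _ hx => neg_le_neg (hP.edgeForm_le_of_mem h hx)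

lemma mem_dualTriangle_iff (hP : IsPolygon b P V) {t u v : E} (h : IsEdge b V t u)
    (h' : IsEdge b V u v) {y : StrongDual ℝ E} :
    y ∈ convexHull ℝ {0, dualVertex b t u, dualVertex b u v} ↔
      (∀ x ∈ V, y u ≤ y x) ∧ -1 ≤ y u := by
  rw [mem_convexHull_triangle]
  constructor
  · rintro ⟨r, s, hr, hs, hrs, rfl⟩
    simp only [_root_.add_apply, _root_.smul_apply, smul_eq_mul,
      dualVertex_apply, edgeForm_right h.pos, edgeForm_left h'.pos]
    refine ⟨fun x hx => ?_, by linarith⟩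
    have hrx := mul_le_mul_of_nonneg_left (h.edgeForm_le hx) hr
    have hsx := mul_le_mul_of_nonneg_left (h'.edgeForm_le hx) hs
    linarith
  · rintro ⟨hmin, hu⟩
    obtain ⟨r, s, hr, hs, hrs, heq⟩ := hP.exists_combination h h' (y := y.toLinearMap)
      (hmin t h.left_mem) (hmin v h'.right_mem)
    refine ⟨r, s, hr, hs, hrs.trans_le (neg_le.1 hu), ?_⟩
    ext x
    exact LinearMap.congr_fun heq x

lemma exists_mem_dualTriangle (hP : IsPolygon b P V) {y : StrongDual ℝ E}
    (hy : y ∈ dualPolytope P) : ∃ t u, IsEdge b V t u ∧ ∀ v, IsEdge b V u v →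
      y ∈ convexHull ℝ {0, dualVertex b t u, dualVertex b u v} := by
  obtain ⟨σ, hσ⟩ := hP.edges_nonempty
  obtain ⟨u, hu, hmin⟩ := V.exists_min_image (fun u => y u) ⟨_, (mem_edges.1 hσ).left_mem⟩
  obtain ⟨t, ht⟩ := hP.exists_isEdge_right hu
  exact ⟨t, u, ht, fun v hv => (hP.mem_dualTriangle_iff ht hv).2
    ⟨hmin, hP.mem_dualPolytope_iff.1 hy u hu⟩⟩

lemma dualTriangle_subset (hP : IsPolygon b P V) {t u v : E} (h : IsEdge b V t u)
    (h' : IsEdge b V u v) :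
    convexHull ℝ {0, dualVertex b t u, dualVertex b u v} ⊆ dualPolytope P := by
  intro y hy
  obtain ⟨hmin, hu⟩ := (hP.mem_dualTriangle_iff h h').1 hy
  exact hP.mem_dualPolytope_iff.2 fun x hx => hu.trans (hmin x hx)

lemma dualPolytope_eq_biUnion_triangle (hP : IsPolygon b P V) {next : E → E}
    (hnext : ∀ u ∈ V, IsEdge b V u (next u)) : dualPolytope P =
      ⋃ σ ∈ edges b V, convexHull ℝ {0, dualVertex b σ.1 σ.2, dualVertex b σ.2 (next σ.2)} := by
  ext y
  rw [Set.mem_iUnion₂]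
  constructor
  · intro hy
    obtain ⟨t, u, h, hyt⟩ := hP.exists_mem_dualTriangle hy
    exact ⟨(t, u), mem_edges.2 h, hyt _ (hnext u h.right_mem)⟩
  · rintro ⟨σ, hσ, hy⟩
    have h := mem_edges.1 hσ
    exact hP.dualTriangle_subset h (hnext _ h.right_mem) hy

lemma exists_separating_form_dual (hP : IsPolygon b P V) {next : E → E}
    (hnext : ∀ u ∈ V, IsEdge b V u (next u)) {σ τ : E × E} (hσ : σ ∈ edges b V)
    (hτ : τ ∈ edges b V) (hne : σ ≠ τ) : ∃ f : StrongDual ℝ E →ₗ[ℝ] ℝ, f ≠ 0 ∧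
      ∀ y ∈ convexHull ℝ {0, dualVertex b σ.1 σ.2, dualVertex b σ.2 (next σ.2)},
        y ∈ convexHull ℝ {0, dualVertex b τ.1 τ.2, dualVertex b τ.2 (next τ.2)} → f y = 0 := by
  have h := mem_edges.1 hσ
  have h' := mem_edges.1 hτ
  have hhead : σ.2 ≠ τ.2 := fun heq => hne (Prod.ext (hP.left_unique h (heq ▸ h')) heq)
  refine ⟨(ContinuousLinearMap.apply ℝ ℝ (σ.2 - τ.2)).toLinearMap, fun h0 => ?_,
    fun y hy hy' => ?_⟩
  · obtain ⟨x, hx⟩ := exists_cross_pos_of_ne_zero b (sub_ne_zero.2 hhead)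
    exact hx.ne' (LinearMap.congr_fun h0 (LinearMap.toContinuousLinearMap ((cross b).flip x)))
  · have hmin := ((hP.mem_dualTriangle_iff h (hnext _ h.right_mem)).1 hy).1
    have hmin' := ((hP.mem_dualTriangle_iff h' (hnext _ h'.right_mem)).1 hy').1
    change y (σ.2 - τ.2) = 0
    rw [map_sub, sub_eq_zero]
    exact (hmin _ h'.right_mem).antisymm (hmin' _ h.right_mem)

lemma dualVertex_mem_extremePoints (hP : IsPolygon b P V) {u v : E} (h : IsEdge b V u v) :
    dualVertex b u v ∈ (dualPolytope P).extremePoints ℝ := by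
  rw [mem_extremePoints_iff_left]
  refine ⟨hP.dualVertex_mem h, ?_⟩
  rintro y hy z hz ⟨α, β, hα, hβ, hαβ, heq⟩
  have htight : ∀ x ∈ P, edgeForm b u v x = 1 → y x = -edgeForm b u v x := by
    intro x hx hx1
    have hsum := congrArg (fun f : StrongDual ℝ E => f x) heq
    simp only [_root_.add_apply, _root_.smul_apply, smul_eq_mul, dualVertex_apply, hx1] at hsum
    rw [hx1]
    nlinarith [hy x hx, hz x hx]
  have hform : y.toLinearMap = -edgeForm b u v := linearMap_eq_of_cross_pos h.pos
    (htight u (hP.vertex_mem h.left_mem) (edgeForm_left h.pos))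
    (htight v (hP.vertex_mem h.right_mem) (edgeForm_right h.pos))
  ext x
  exact LinearMap.congr_fun hform x

lemma zero_notMem_extremePoints_dualPolytope (hP : IsPolygon b P V) :
    (0 : StrongDual ℝ E) ∉ (dualPolytope P).extremePoints ℝ := by
  intro hzero
  obtain ⟨σ, hσ⟩ := hP.edges_nonempty
  have hσ' := mem_edges.1 hσ
  set y := dualVertex b σ.1 σ.2
  have hsmall : ∀ᶠ c in nhds (0 : ℝ), ∀ x ∈ V, |c * y x| < 1 :=
    V.eventually_all.2 fun x _ => ContinuousAt.eventually_lt
      (Continuous.continuousAt (by fun_prop)) continuousAt_const (by simp)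
  obtain ⟨c, hc, hcpos⟩ :=
    ((hsmall.filter_mono nhdsWithin_le_nhds).and (self_mem_nhdsWithin (s := Set.Ioi 0))).exists
  have hpos : c • y ∈ dualPolytope P :=
    hP.mem_dualPolytope_iff.2 fun x hx => (abs_lt.1 (hc x hx)).1.le
  have hneg : -(c • y) ∈ dualPolytope P :=
    hP.mem_dualPolytope_iff.2 fun x hx => neg_le_neg (abs_lt.1 (hc x hx)).2.le
  have hy : c • y = 0 := (mem_extremePoints_iff_left.1 hzero).2 _ hpos _ hneg
    ⟨1 / 2, 1 / 2, by norm_num, by norm_num, by norm_num, by rw [smul_neg, add_neg_cancel]⟩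
  have happly : c * -edgeForm b σ.1 σ.2 σ.1 = 0 := DFunLike.congr_fun hy σ.1
  rw [edgeForm_left hσ'.pos] at happly
  exact (ne_of_gt hcpos) (by linarith)

lemma extremePoints_dualPolytope (hP : IsPolygon b P V) :
    (dualPolytope P).extremePoints ℝ = {y | ∃ u v, IsEdge b V u v ∧ y = dualVertex b u v} := by
  refine Set.Subset.antisymm (fun y hy => ?_) ?_
  · obtain ⟨t, u, h, hyt⟩ := hP.exists_mem_dualTriangle (extremePoints_subset hy)
    obtain ⟨v, hv⟩ := hP.exists_isEdge_left h.right_mem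
    rcases extremePoints_convexHull_subset (inter_extremePoints_subset_extremePoints_of_subset
      (hP.dualTriangle_subset h hv) ⟨hyt v hv, hy⟩) with rfl | rfl | rfl
    · exact absurd hy hP.zero_notMem_extremePoints_dualPolytope
    · exact ⟨t, u, h, rfl⟩
    · exact ⟨u, v, hv, rfl⟩
  · rintro _ ⟨u, v, h, rfl⟩
    exact hP.dualVertex_mem_extremePoints h

lemma normalizedVolume_eq [MeasurableSpace E] [BorelSpace E]
    (hP : IsPolygon b P V) : normalizedVolume (Submodule.span ℤ (Set.range b)) P =
      ∑ σ ∈ edges b V, cross b σ.1 σ.2 := by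
  conv_lhs => rw [hP.eq_biUnion_triangle]
  rw [normalizedVolume_biUnion_triangle b
    fun σ hσ τ hτ hne => hP.exists_separating_form hσ hτ hne]
  exact Finset.sum_congr rfl fun σ hσ => abs_of_pos (mem_edges.1 hσ).pos

lemma normalizedVolume_dualPolytope_eq (hP : IsPolygon b P V) {next : E → E}
    (hnext : ∀ u ∈ V, IsEdge b V u (next u)) :
    normalizedVolume (dualLattice (Submodule.span ℤ (Set.range b))) (dualPolytope P) =
      ∑ σ ∈ edges b V, dualArea b σ.1 σ.2 (next σ.2) := by
  rw [dualLattice_eq_span, hP.dualPolytope_eq_biUnion_triangle hnext,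
    normalizedVolume_biUnion_triangle (strongDualBasis b)
      fun σ hσ τ hτ hne => hP.exists_separating_form_dual hnext hσ hτ hne]
  refine Finset.sum_congr rfl fun σ hσ => ?_
  have h := mem_edges.1 hσ
  have h' := hnext _ h.right_mem
  rw [cross_dualVertex h.pos h'.pos, abs_of_nonneg (dualArea_nonneg h h')]

end IsPolygon

end Dual

section Vertices

variable {E : Type*} [NormedAddCommGroup E] [NormedSpace ℝ E] {N : Submodule ℤ E} {P : Set E}

namespace IsLatticePolytope

lemma isCompact (hP : IsLatticePolytope N P) : IsCompact P := by
  obtain ⟨s, -, rfl⟩ := hP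
  exact s.finite_toSet.isCompact_convexHull ℝ

lemma convex (hP : IsLatticePolytope N P) : Convex ℝ P := by
  obtain ⟨s, -, rfl⟩ := hP
  exact convex_convexHull ℝ _

lemma finite_vertices (hP : IsLatticePolytope N P) : (vertices P).Finite := by
  obtain ⟨s, -, rfl⟩ := hP
  exact s.finite_toSet.subset extremePoints_convexHull_subset

lemma eq_convexHull_vertices (hP : IsLatticePolytope N P) : P = convexHull ℝ (vertices P) := by
  rw [← (hP.finite_vertices.isCompact_convexHull ℝ).isClosed.closure_eq, vertices,
    closure_convexHull_extremePoints hP.isCompact hP.convex]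

end IsLatticePolytope

lemma exists_pos_of_zero_mem_interior_convexHull {s : Set E}
    (h : (0 : E) ∈ interior (convexHull ℝ s)) {f : E →ₗ[ℝ] ℝ} (hf : f ≠ 0) :
    ∃ v ∈ s, 0 < f v := by
  by_contra! hle
  obtain ⟨y, hy⟩ := LinearMap.surjective hf 1
  have htendsto : Filter.Tendsto (fun c : ℝ => c • y) (nhds 0) (nhds 0) := by
    simpa only [zero_smul] using (show Continuous fun c : ℝ => c • y by fun_prop).tendsto 0
  have hsmall := htendsto.eventually (mem_interior_iff_mem_nhds.1 h)
  obtain ⟨c, hc, hcpos⟩ :=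
    ((hsmall.filter_mono nhdsWithin_le_nhds).and (self_mem_nhdsWithin (s := Set.Ioi 0))).exists
  have hnonpos : f (c • y) ≤ 0 := convexHull_min hle (convex_halfSpace_le f.isLinear 0) hc
  rw [map_smul, hy, smul_eq_mul, mul_one] at hnonpos
  exact hnonpos.not_gt hcpos

lemma IsLDP.isPolygon (hP : IsLDP N P) {V : Finset E} (hV : (V : Set E) = vertices P)
    (b : Basis (Fin 2) ℝ E) : IsPolygon b P V where
  eq_hull := by rw [hV, ← hP.isLatticePolytope.eq_convexHull_vertices]
  zero_mem := interior_subset hP.zero_mem_interior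
  exists_cross_pos x hx := by
    obtain ⟨y, hy⟩ := exists_cross_pos_of_ne_zero b hx
    have hint := hP.zero_mem_interior
    rw [hP.isLatticePolytope.eq_convexHull_vertices, ← hV] at hint
    exact exists_pos_of_zero_mem_interior_convexHull hint
      fun h0 => hy.ne' (LinearMap.congr_fun h0 y)
  extreme := hV.le
  ne_zero u hu := (hP.primitive_vertices u (hV ▸ hu)).2.1

end Vertices

section Hull

variable {E : Type*} [AddCommGroup E] [Module ℝ E] {b : Basis (Fin 2) ℝ E} {F : Set E}
  {u v x : E}

lemma inCone_of_mem_hull (hF : ∀ x ∈ F, InCone b u v x) (hx : x ∈ PointedCone.hull ℝ F) :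
    InCone b u v x := by
  induction hx using Submodule.span_induction with
  | mem x hx => exact hF x hx
  | zero => simp [InCone]
  | add x y _ _ hx hy =>
    simp only [InCone, map_add, LinearMap.add_apply]
    exact ⟨add_nonneg hx.1 hy.1, add_nonneg hx.2 hy.2⟩
  | smul c x _ hx =>
    simp only [InCone, ← Nonneg.coe_smul, map_smul, LinearMap.smul_apply, smul_eq_mul]
    exact ⟨mul_nonneg c.2 hx.1, mul_nonneg c.2 hx.2⟩

lemma mem_hull_of_inCone (huv : 0 < cross b u v) (hu : u ∈ F) (hv : v ∈ F)
    (hx : InCone b u v x) : x ∈ PointedCone.hull ℝ F := by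
  rw [eq_of_cross_pos b huv x]
  exact add_mem
    (Submodule.smul_mem _ (⟨_, div_nonneg hx.2 huv.le⟩ : NNReal) (PointedCone.subset_hull hu))
    (Submodule.smul_mem _ (⟨_, div_nonneg hx.1 huv.le⟩ : NNReal) (PointedCone.subset_hull hv))

end Hull

section PrimitiveHull

variable {E : Type*} [NormedAddCommGroup E] [NormedSpace ℝ E]

lemma coneDim_hull (F : Set E) :
    coneDim (PointedCone.hull ℝ F) = finrank ℝ (Submodule.span ℝ F) := by
  rw [coneDim, Submodule.span_span_of_tower]

lemma IsPrimitive.eq_of_mem_hull_singleton {b : Basis (Fin 2) ℝ E} {u w : E}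
    (hu : IsPrimitive (Submodule.span ℤ (Set.range b)) u)
    (hw : IsPrimitive (Submodule.span ℤ (Set.range b)) w)
    (h : w ∈ PointedCone.hull ℝ {u}) : w = u := by
  obtain ⟨⟨c, hc⟩, rfl⟩ := Submodule.mem_span_singleton.1 h
  change c • u = u
  obtain ⟨k, rfl⟩ := hu.exists_int_of_smul_mem (c := c) hw.1
  have hunit : IsUnit k := hw.2.2 u hu.1 k (Int.cast_smul_eq_zsmul ℝ k u)
  have hk : 0 ≤ k := by exact_mod_cast hc
  obtain rfl : k = 1 := by
    rcases Int.isUnit_iff.1 hunit with h | h <;> omega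
  rw [Int.cast_one, one_smul]

end PrimitiveHull

section Fan

variable {E : Type*} [NormedAddCommGroup E] [NormedSpace ℝ E] {b : Basis (Fin 2) ℝ E} {P : Set E}
  {V : Finset E}

lemma hull_level_mem_faceFan [FiniteDimensional ℝ E] (h0 : (0 : E) ∈ P) {f : E →ₗ[ℝ] ℝ} {c : ℝ}
    (hc : c ≠ 0) (hne : ∃ x ∈ P, f x = c) (hle : ∀ x ∈ P, f x ≤ c) :
    PointedCone.hull ℝ {x | x ∈ P ∧ f x = c} ∈ faceFan P := by
  obtain ⟨x₀, hx₀, rfl⟩ := hne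
  refine ⟨_, fun _ => ⟨LinearMap.toContinuousLinearMap f, ?_⟩, fun heq => ?_, rfl⟩
  · ext x
    exact and_congr_right fun hx =>
      ⟨fun h y hy => (hle y hy).trans h.ge, fun h => (hle x hx).antisymm (h x₀ hx₀)⟩
  · have hzero : (0 : E) ∈ {x | x ∈ P ∧ f x = f x₀} := heq.symm ▸ h0
    exact hc (hzero.2.symm.trans (map_zero f))

namespace IsPolygon

lemma exists_mem_dualPolytope_of_isExposed (hP : IsPolygon b P V) {F : Set E}
    (hF : IsExposed ℝ P F) (hFP : F ≠ P) (hne : F.Nonempty) :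
    ∃ y ∈ dualPolytope P, ∀ x ∈ F, y x = -1 := by
  obtain ⟨l, rfl⟩ := hF hne
  obtain ⟨x₀, hx₀, hmax⟩ := hne
  have hpos : 0 < l x₀ := by
    by_contra! hle
    have hzero : l.toLinearMap = 0 := hP.eq_zero_of_forall_nonpos fun u hu =>
      (hmax u (hP.vertex_mem hu)).trans hle
    refine hFP (Set.sep_eq_self_iff_mem_true.2 fun x _ y _ => ?_)
    exact (LinearMap.congr_fun hzero y).trans_le (LinearMap.congr_fun hzero x).ge
  refine ⟨(-(l x₀)⁻¹) • l, fun x hx => ?_, fun x hx => ?_⟩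
  · rw [_root_.smul_apply, smul_eq_mul, neg_mul, neg_le_neg_iff, inv_mul_le_iff₀ hpos, mul_one]
    exact hmax x hx
  · rw [_root_.smul_apply, smul_eq_mul, neg_mul, (hmax x hx.1).antisymm (hx.2 x₀ hx₀),
      inv_mul_cancel₀ hpos.ne']

lemma exists_isEdge_of_isExposed (hP : IsPolygon b P V) {F : Set E}
    (hF : IsExposed ℝ P F) (hFP : F ≠ P) (hne : F.Nonempty) :
    ∃ u v, IsEdge b V u v ∧ ∀ x ∈ F, edgeForm b u v x = 1 := by
  have : FiniteDimensional ℝ E := b.finiteDimensional_of_finite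
  obtain ⟨y, hy, hyF⟩ := hP.exists_mem_dualPolytope_of_isExposed hF hFP hne
  obtain ⟨t, u, h, htri⟩ := hP.exists_mem_dualTriangle hy
  obtain ⟨v, h'⟩ := hP.exists_isEdge_left h.right_mem
  obtain ⟨r, s, hr, hs, hrs, rfl⟩ := mem_convexHull_triangle.1 (htri v h')
  have hsum : ∀ x ∈ F, r * edgeForm b t u x + s * edgeForm b u v x = 1 := by
    intro x hx
    have happly := hyF x hx
    simp only [_root_.add_apply, _root_.smul_apply, smul_eq_mul, dualVertex_apply] at happly
    linarith
  have hle : ∀ x ∈ F, edgeForm b t u x ≤ 1 := fun x hx => hP.edgeForm_le_of_mem h (hF.subset hx)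
  have hle' : ∀ x ∈ F, edgeForm b u v x ≤ 1 :=
    fun x hx => hP.edgeForm_le_of_mem h' (hF.subset hx)
  rcases hr.eq_or_lt with rfl | hr
  · refine ⟨u, v, h', fun x hx => ?_⟩
    have hsx := hsum x hx
    rw [zero_add] at hrs
    rw [zero_mul, zero_add] at hsx
    obtain rfl : s = 1 := hrs.antisymm (hsx.ge.trans (mul_le_of_le_one_right hs (hle' x hx)))
    rwa [one_mul] at hsx
  · exact ⟨t, u, h, fun x hx => (hle x hx).antisymm (by nlinarith [hsum x hx, hle x hx, hle' x hx])⟩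

lemma hull_vertex_mem_faceFan (hP : IsPolygon b P V) {u : E} (hu : u ∈ V) :
    PointedCone.hull ℝ {u} ∈ faceFan P := by
  have : FiniteDimensional ℝ E := b.finiteDimensional_of_finite
  obtain ⟨t, h⟩ := hP.exists_isEdge_right hu
  obtain ⟨v, h'⟩ := hP.exists_isEdge_left hu
  have hlevel : {x | x ∈ P ∧ (edgeForm b t u + edgeForm b u v) x = 2} = {u} := by
    refine Set.eq_singleton_iff_unique_mem.2 ⟨⟨hP.vertex_mem hu, ?_⟩, ?_⟩
    · rw [LinearMap.add_apply, edgeForm_right h.pos, edgeForm_left h'.pos, one_add_one_eq_two]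
    · rintro x ⟨hx, hsum⟩
      rw [LinearMap.add_apply] at hsum
      have hx1 : edgeForm b t u x = 1 := by
        linarith [hP.edgeForm_le_of_mem h hx, hP.edgeForm_le_of_mem h' hx]
      have hx1' : edgeForm b u v x = 1 := by linarith
      have hcross : cross b u x = 0 := by
        refine le_antisymm ?_ (hP.inCone_of_edgeForm_eq_one h' hx hx1').1
        rw [cross_swap]
        exact neg_nonpos.2 (hP.inCone_of_edgeForm_eq_one h hx hx1).2
      rw [edgeForm_apply, hcross, zero_add] at hx1'
      rw [eq_of_cross_pos b h'.pos x, hcross, hx1', one_smul, zero_div, zero_smul, add_zero]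
  rw [← hlevel]
  refine hull_level_mem_faceFan hP.zero_mem two_ne_zero ?_ fun x hx => ?_
  · exact ⟨u, hlevel.symm.subset (Set.mem_singleton u)⟩
  · rw [LinearMap.add_apply, ← one_add_one_eq_two]
    exact add_le_add (hP.edgeForm_le_of_mem h hx) (hP.edgeForm_le_of_mem h' hx)

lemma exists_eq_singleton_of_coneDim_eq_one (hP : IsPolygon b P V) {F : Set E}
    (hF : IsExposed ℝ P F) (hFP : F ≠ P) (hdim : coneDim (PointedCone.hull ℝ F) = 1) :
    ∃ u ∈ V, F = {u} := by
  rw [coneDim_hull] at hdim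
  obtain ⟨u, hu⟩ : F.Nonempty := by
    rw [Set.nonempty_iff_ne_empty]
    rintro rfl
    rw [Submodule.span_empty, finrank_bot] at hdim
    exact zero_ne_one hdim
  obtain ⟨t, v, -, hone⟩ := hP.exists_isEdge_of_isExposed hF hFP ⟨u, hu⟩
  have hu0 : (⟨u, Submodule.subset_span hu⟩ : Submodule.span ℝ F) ≠ 0 := by
    rw [ne_eq, Submodule.mk_eq_zero]
    rintro rfl
    simpa using hone 0 hu
  have hsingle : F = {u} := by
    refine Set.eq_singleton_iff_unique_mem.2 ⟨hu, fun x hx => ?_⟩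
    obtain ⟨c, hc⟩ := (finrank_eq_one_iff_of_nonzero' _ hu0).1 hdim ⟨x, Submodule.subset_span hx⟩
    obtain rfl : c • u = x := congrArg Subtype.val hc
    have hc1 := hone _ hx
    rw [map_smul, hone u hu, smul_eq_mul, mul_one] at hc1
    rw [hc1, one_smul]
  have hextreme : u ∈ P.extremePoints ℝ := isExtreme_singleton.1 (hsingle ▸ hF.isExtreme)
  rw [hP.eq_hull] at hextreme
  exact ⟨u, extremePoints_convexHull_subset hextreme, hsingle⟩

end IsPolygon

namespace IsAnticanonical

variable {N : Submodule ℤ E} {κ : E → ℝ}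

lemma apply_vertex (hκ : IsAnticanonical N (faceFan P) κ) (hP : IsPolygon b P V)
    {u : E} (hu : u ∈ V) (hprim : IsPrimitive N u) : κ u = -1 := by
  refine hκ.ray_generator _ (hP.hull_vertex_mem_faceFan hu) ?_ u
    (PointedCone.subset_hull rfl) hprim
  rw [coneDim_hull, finrank_span_singleton (hP.ne_zero u hu)]

lemma eq_neg_edgeForm (hκ : IsAnticanonical N (faceFan P) κ) (hP : IsPolygon b P V)
    (hprim : ∀ u ∈ V, IsPrimitive N u) {u v x : E} (h : IsEdge b V u v) (hx : InCone b u v x) :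
    κ x = -edgeForm b u v x := by
  have : FiniteDimensional ℝ E := b.finiteDimensional_of_finite
  have hu : u ∈ {x | x ∈ P ∧ edgeForm b u v x = 1} :=
    ⟨hP.vertex_mem h.left_mem, edgeForm_left h.pos⟩
  have hv : v ∈ {x | x ∈ P ∧ edgeForm b u v x = 1} :=
    ⟨hP.vertex_mem h.right_mem, edgeForm_right h.pos⟩
  obtain ⟨m, hm⟩ := hκ.linear_on_cone _ (hull_level_mem_faceFan hP.zero_mem one_ne_zero ⟨u, hu⟩
    fun x hx => hP.edgeForm_le_of_mem h hx)
  have hform : m = -edgeForm b u v := by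
    refine linearMap_eq_of_cross_pos h.pos ?_ ?_
    · rw [← hm u (PointedCone.subset_hull hu), hκ.apply_vertex hP h.left_mem (hprim u h.left_mem),
        LinearMap.neg_apply, edgeForm_left h.pos]
    · rw [← hm v (PointedCone.subset_hull hv),
        hκ.apply_vertex hP h.right_mem (hprim v h.right_mem), LinearMap.neg_apply,
        edgeForm_right h.pos]
  rw [hm x (mem_hull_of_inCone h.pos hu hv hx), hform, LinearMap.neg_apply]

end IsAnticanonical

namespace IsPolygon

lemma isAnticanonical_of_eq_neg_edgeForm (hP : IsPolygon b P V)
    (hprim : ∀ u ∈ V, IsPrimitive (Submodule.span ℤ (Set.range b)) u) {κ : E → ℝ}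
    (hκ : ∀ u v x, IsEdge b V u v → InCone b u v x → κ x = -edgeForm b u v x) :
    IsAnticanonical (Submodule.span ℤ (Set.range b)) (faceFan P) κ := by
  constructor
  · rintro σ ⟨F, hF, hFP, rfl⟩
    rcases F.eq_empty_or_nonempty with rfl | hne
    · obtain ⟨u, v, h, -⟩ := hP.exists_inCone 0
      exact ⟨-edgeForm b u v, fun x hx => hκ u v x h (inCone_of_mem_hull (by simp) hx)⟩
    · obtain ⟨u, v, h, hone⟩ := hP.exists_isEdge_of_isExposed hF hFP hne
      exact ⟨-edgeForm b u v, fun x hx => hκ u v x h (inCone_of_mem_hull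
        (fun y hy => hP.inCone_of_edgeForm_eq_one h (hF.subset hy) (hone y hy)) hx)⟩
  · rintro σ ⟨F, hF, hFP, rfl⟩ hdim w hw hwprim
    obtain ⟨u, hu, rfl⟩ := hP.exists_eq_singleton_of_coneDim_eq_one hF hFP hdim
    obtain rfl := (hprim u hu).eq_of_mem_hull_singleton hwprim hw
    obtain ⟨v, h⟩ := hP.exists_isEdge_left hu
    rw [hκ w v w h (hP.inCone_of_edgeForm_eq_one h (hP.vertex_mem hu) (edgeForm_left h.pos)),
      edgeForm_left h.pos]

lemma existsUnique_isAnticanonical (hP : IsPolygon b P V)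
    (hprim : ∀ u ∈ V, IsPrimitive (Submodule.span ℤ (Set.range b)) u) :
    ∃! κ : E → ℝ, IsAnticanonical (Submodule.span ℤ (Set.range b)) (faceFan P) κ := by
  choose u v h hx using hP.exists_inCone
  refine ⟨fun x => -edgeForm b (u x) (v x) x, hP.isAnticanonical_of_eq_neg_edgeForm hprim ?_, ?_⟩
  · intro u' v' x h' hx'
    rw [neg_inj]
    exact (h'.edgeForm_le_of_inCone (h x) hx').antisymm ((h x).edgeForm_le_of_inCone h' (hx x))
  · exact fun κ hκ => funext fun x => hκ.eq_neg_edgeForm hP hprim (h x) (hx x)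

end IsPolygon

end Fan

section LatticePoints

variable {E : Type*} [NormedAddCommGroup E] [NormedSpace ℝ E] {b : Basis (Fin 2) ℝ E} {P : Set E}
  {V A : Finset E} {u v w n : E}

namespace IsPolygon

lemma finite_inter_span (hP : IsPolygon b P V) :
    (P ∩ (Submodule.span ℤ (Set.range b) : Set E)).Finite := by
  have : FiniteDimensional ℝ E := b.finiteDimensional_of_finite
  have : ProperSpace E := FiniteDimensional.proper_real E
  refine ZSpan.setFinite_inter b ?_
  rw [hP.eq_hull]
  exact (V.finite_toSet.isCompact_convexHull ℝ).isBounded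

lemma eq_one_of_smul_mem (hP : IsPolygon b P V) (hu : u ∈ V)
    (hprim : IsPrimitive (Submodule.span ℤ (Set.range b)) u) {c : ℝ} (hc : 0 < c)
    (hcP : c • u ∈ P) (hcN : c • u ∈ Submodule.span ℤ (Set.range b)) : c = 1 := by
  have hle := hP.le_one_of_smul_mem hu hcP
  obtain ⟨k, rfl⟩ := hprim.exists_int_of_smul_mem hcN
  norm_cast at hc hle ⊢
  omega

lemma edgeForm_eq_one_of_mem_ray (hP : IsPolygon b P V)
    (hprim : ∀ u ∈ V, IsPrimitive (Submodule.span ℤ (Set.range b)) u) (h : IsEdge b V u v)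
    (hnP : n ∈ P) (hnN : n ∈ Submodule.span ℤ (Set.range b)) (hn0 : n ≠ 0) (hn : InCone b u v n)
    (hray : ¬(0 < cross b u n ∧ 0 < cross b n v)) : edgeForm b u v n = 1 := by
  have hmultiple {w : E} (hw : w ∈ V) (hw1 : edgeForm b u v w = 1) {c : ℝ} (hc : 0 ≤ c)
      (heq : n = c • w) : edgeForm b u v n = 1 := by
    subst heq
    have hcpos : 0 < c := hc.lt_of_ne' (left_ne_zero_of_smul hn0)
    rw [hP.eq_one_of_smul_mem hw (hprim w hw) hcpos hnP hnN, one_smul, hw1]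
  have hn_eq := eq_of_cross_pos b h.pos n
  rcases hn.1.eq_or_lt with hun | hun
  · rw [← hun, zero_div, zero_smul, add_zero] at hn_eq
    exact hmultiple h.left_mem (edgeForm_left h.pos) (div_nonneg hn.2 h.pos.le) hn_eq
  · have hnv : cross b n v = 0 := (not_lt.1 fun hnv => hray ⟨hun, hnv⟩).antisymm hn.2
    rw [hnv, zero_div, zero_smul, zero_add] at hn_eq
    exact hmultiple h.right_mem (edgeForm_right h.pos) (div_nonneg hn.1 h.pos.le) hn_eq

open Classical in
lemma anticanonical_add_one_sq (hP : IsPolygon b P V)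
    (hprim : ∀ u ∈ V, IsPrimitive (Submodule.span ℤ (Set.range b)) u) {κ : E → ℝ}
    (hκ : IsAnticanonical (Submodule.span ℤ (Set.range b)) (faceFan P) κ)
    (hnP : n ∈ P) (hnN : n ∈ Submodule.span ℤ (Set.range b)) :
    (κ n + 1) ^ 2 = (if n = 0 then 1 else 0) + ∑ σ ∈ edges b V,
      if 0 < cross b σ.1 n ∧ 0 < cross b n σ.2 then (1 - edgeForm b σ.1 σ.2 n) ^ 2 else 0 := by
  obtain ⟨u, v, h, hn⟩ := hP.exists_inCone n
  rw [hκ.eq_neg_edgeForm hP hprim h hn,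
    hP.sum_edges_ite_cone h hn fun σ => (1 - edgeForm b σ.1 σ.2 n) ^ 2, neg_add_eq_sub]
  rcases eq_or_ne n 0 with rfl | hn0
  · simp
  rw [if_neg hn0, zero_add]
  split_ifs with hopen
  · rfl
  · rw [hP.edgeForm_eq_one_of_mem_ray hprim h hnP hnN hn0 hn hopen, sub_self, zero_pow two_ne_zero]

lemma sum_anticanonical_add_one_sq (hP : IsPolygon b P V)
    (hprim : ∀ u ∈ V, IsPrimitive (Submodule.span ℤ (Set.range b)) u) {κ : E → ℝ}
    (hκ : IsAnticanonical (Submodule.span ℤ (Set.range b)) (faceFan P) κ)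
    (hA : ∀ n, n ∈ A ↔ n ∈ P ∧ n ∈ Submodule.span ℤ (Set.range b)) :
    ∑ n ∈ A, (κ n + 1) ^ 2 = 1 + ∑ σ ∈ edges b V, edgeSum b A σ.1 σ.2 := by
  classical
  have h0 : (0 : E) ∈ A := (hA 0).2 ⟨hP.zero_mem, Submodule.zero_mem _⟩
  have hpoint : ∀ n ∈ A, (κ n + 1) ^ 2 = _ := fun n hn =>
    hP.anticanonical_add_one_sq hprim hκ ((hA n).1 hn).1 ((hA n).1 hn).2
  rw [Finset.sum_congr rfl hpoint, Finset.sum_add_distrib, Finset.sum_ite_eq', if_pos h0,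
    Finset.sum_comm]
  simp only [edgeSum, Finset.sum_filter]

end IsPolygon

end LatticePoints

section Reflexive

variable {E : Type*} [NormedAddCommGroup E] [NormedSpace ℝ E] {b : Basis (Fin 2) ℝ E} {P : Set E}
  {V A : Finset E} {u v : E}

namespace IsPolygon

lemma dualVertex_mem_of_edgeSum_eq_zero [FiniteDimensional ℝ E] (hP : IsPolygon b P V)
    (hprim : ∀ u ∈ V, IsPrimitive (Submodule.span ℤ (Set.range b)) u)
    (hA : ∀ n, n ∈ A ↔ n ∈ P ∧ n ∈ Submodule.span ℤ (Set.range b)) (huv : IsEdge b V u v)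
    (hzero : edgeSum b A u v = 0) :
    dualVertex b u v ∈ dualLattice (Submodule.span ℤ (Set.range b)) := by
  have hu := hprim u huv.left_mem
  obtain ⟨w, hw, h, d, huw, hd, hhd, hv⟩ :=
    exists_normal_form hu (hprim v huv.right_mem) huv.pos
  obtain ⟨k, hk⟩ := hP.exists_edgeForm_smul_add_eq_one hA huv hzero hu.1 hw huw hd hhd hv
  rw [map_add, map_smul, edgeForm_left huv.pos, smul_eq_mul, mul_one] at hk
  intro n hn
  obtain ⟨i, j, rfl⟩ := exists_eq_intCast_smul_add hu.1 hw huw hn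
  refine ⟨j * k - i - j, ?_⟩
  rw [dualVertex_apply, map_add, map_smul, map_smul, edgeForm_left huv.pos, smul_eq_mul,
    smul_eq_mul]
  push_cast
  linear_combination (-j : ℝ) * hk

lemma edgeSum_eq_zero_of_dualVertex_mem [FiniteDimensional ℝ E] (hP : IsPolygon b P V)
    (hA : ∀ n, n ∈ A ↔ n ∈ P ∧ n ∈ Submodule.span ℤ (Set.range b)) (huv : IsEdge b V u v)
    (hmem : dualVertex b u v ∈ dualLattice (Submodule.span ℤ (Set.range b))) :
    edgeSum b A u v = 0 := by
  refine Finset.sum_eq_zero fun n hn => ?_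
  obtain ⟨hnN, hun, hnv, hle⟩ := (hP.mem_filter_cone_iff hA huv n).1 hn
  obtain ⟨k, hk⟩ := hmem n hnN
  have hpos : 0 < edgeForm b u v n := by
    rw [edgeForm_apply]
    exact div_pos (add_pos hun hnv) huv.pos
  rw [dualVertex_apply, neg_eq_iff_eq_neg] at hk
  rw [hk] at hpos hle ⊢
  norm_cast at hpos hle
  obtain rfl : k = -1 := by omega
  norm_num

lemma isReflexive_iff_sum_edgeSum_eq_zero (hP : IsPolygon b P V)
    (hprim : ∀ u ∈ V, IsPrimitive (Submodule.span ℤ (Set.range b)) u)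
    (hA : ∀ n, n ∈ A ↔ n ∈ P ∧ n ∈ Submodule.span ℤ (Set.range b)) :
    IsReflexive (Submodule.span ℤ (Set.range b)) P ↔
      ∑ σ ∈ edges b V, edgeSum b A σ.1 σ.2 = 0 := by
  have : FiniteDimensional ℝ E := b.finiteDimensional_of_finite
  rw [Finset.sum_eq_zero_iff_of_nonneg fun σ _ => edgeSum_nonneg A σ.1 σ.2, IsReflexive, vertices,
    hP.extremePoints_dualPolytope]
  constructor
  · intro h σ hσ
    have huv := mem_edges.1 hσ
    exact hP.edgeSum_eq_zero_of_dualVertex_mem hA huv (h ⟨_, _, huv, rfl⟩)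
  · rintro h _ ⟨u, v, huv, rfl⟩
    exact hP.dualVertex_mem_of_edgeSum_eq_zero hprim hA huv (h (u, v) (mem_edges.2 huv))

lemma normalizedVolume_add_normalizedVolume_dualPolytope [FiniteDimensional ℝ E]
    [MeasurableSpace E] [BorelSpace E] (hP : IsPolygon b P V)
    (hprim : ∀ u ∈ V, IsPrimitive (Submodule.span ℤ (Set.range b)) u)
    (hV : ∀ u ∈ V, b.coord 1 u ≠ 0)
    (hA : ∀ n, n ∈ A ↔ n ∈ P ∧ n ∈ Submodule.span ℤ (Set.range b)) :
    normalizedVolume (Submodule.span ℤ (Set.range b)) P +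
        normalizedVolume (dualLattice (Submodule.span ℤ (Set.range b))) (dualPolytope P) =
      12 * (1 + ∑ σ ∈ edges b V, edgeSum b A σ.1 σ.2) := by
  obtain ⟨next, hnext⟩ := hP.exists_next
  rw [hP.normalizedVolume_eq, hP.normalizedVolume_dualPolytope_eq hnext,
    hP.sum_cross_add_sum_dualArea hprim hV hA hnext]

end IsPolygon

end Reflexive

end LDP

theorem corollary4p5 {E : Type*} [NormedAddCommGroup E] [NormedSpace ℝ E] [FiniteDimensional ℝ E]
    [MeasurableSpace E] [BorelSpace E] (hE : Module.finrank ℝ E = 2)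
    (N : Submodule ℤ E) [DiscreteTopology N] [IsZLattice ℝ N]
    (Δ : Set E) (hΔ : LDP.IsLDP N Δ) :
    (Δ ∩ N).Finite ∧
    (∃! κ : E → ℝ, LDP.IsAnticanonical N (LDP.faceFan Δ) κ) ∧
    (∀ κ : E → ℝ, LDP.IsAnticanonical N (LDP.faceFan Δ) κ →
      LDP.normalizedVolume N Δ
          + LDP.normalizedVolume (LDP.dualLattice N) (LDP.dualPolytope Δ) =
        12 * ∑ᶠ n ∈ Δ ∩ N, (κ n + 1) ^ 2) ∧
    12 ≤ LDP.normalizedVolume N Δ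
          + LDP.normalizedVolume (LDP.dualLattice N) (LDP.dualPolytope Δ) ∧
    (LDP.normalizedVolume N Δ
          + LDP.normalizedVolume (LDP.dualLattice N) (LDP.dualPolytope Δ) = 12 ↔
      LDP.IsReflexive N Δ) := by
  have hfin := hΔ.isLatticePolytope.finite_vertices
  have hV : (hfin.toFinset : Set E) = LDP.vertices Δ := hfin.coe_toFinset
  have hprim : ∀ u ∈ hfin.toFinset, LDP.IsPrimitive N u :=
    fun u hu => hΔ.primitive_vertices u (hfin.mem_toFinset.1 hu)
  obtain ⟨b, rfl, hcoord⟩ := LDP.exists_basis_coord_one_ne_zero hE N hfin.toFinset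
    (fun u hu => (hprim u hu).1) (fun u hu => (hprim u hu).2.1)
  have hP := hΔ.isPolygon hV b
  have hA (n : E) := hP.finite_inter_span.mem_toFinset (a := n)
  have hvol := hP.normalizedVolume_add_normalizedVolume_dualPolytope hprim hcoord hA
  have hnonneg := Finset.sum_nonneg fun σ (_ : σ ∈ LDP.edges b hfin.toFinset) =>
    LDP.edgeSum_nonneg (b := b) hP.finite_inter_span.toFinset σ.1 σ.2
  refine ⟨hP.finite_inter_span, hP.existsUnique_isAnticanonical hprim, fun κ hκ => ?_, ?_, ?_⟩
  · rw [hvol, finsum_mem_eq_finite_toFinset_sum _ hP.finite_inter_span,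
      hP.sum_anticanonical_add_one_sq hprim hκ hA]
  · linarith
  · rw [hvol, hP.isReflexive_iff_sum_edgeSum_eq_zero hprim hA]
    constructor <;> intro h <;> linarith
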